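/- Theorem 4.3. Functions on $[0,1]$ take values in $\mathbb K=\mathbb R$ or $\mathbb C$. Let $\Lambda=(\lambda_k)_{k\ge 0}$ be a strictly increasing sequence of non-negative real numbers satisfying the Müntz condition $\sum_{\lambda\in\Lambda\setminus\{0\}}1/\lambda<\infty$. Let $M_\Lambda$ be the linear span of the functions $x\mapsto x^{\lambda}$, $\lambda\in\Lambda$, let $M_\Lambda^1$ be its closure in $L^1([0,1])$ and $M_\Lambda^\infty$ its closure in $C=C([0,1])$ with the supremum norm; write $1+\Lambda=(1+\lambda_k)_{k\ge0}$. For a bounded operator $T:X\to Y$ between Banach spaces let $\|T\|_e$ (respectively $\|T\|_{e,w}$) be the distance in operator norm from $T$ to the compact (respectively weakly compact) operators from $X$ to $Y$. 1. Every $f\in M_\Lambda^1$ has a representative that is continuous on $[0,1)$; let $f(0)$ be its value at $0$. The Cesàro operator $\Gamma_\Lambda$, defined by $\Gamma_\Lambda f(0)=f(0)$ and $\Gamma_\Lambda f(x)=\frac1x\int_0^x f(t)\,dt$ for $0<x\le1$, is a bounded operator from $M_\Lambda^1$ to $M_\Lambda^\infty$. Viewed as a map from $M_\Lambda^1$ to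 $M_\Lambda^\infty$, and also viewed as a map from $M_\Lambda^1$ to $C$, it satisfies $\|\Gamma_\Lambda\|_e=\|\Gamma_\Lambda\|_{e,w}=\frac12$. 2. The Volterra operator $V_\Lambda$, defined by $V_\Lambda f(x)=\int_0^x f(t)\,dt$ for $0\le x\le 1$, is a bounded operator from $M_\Lambda^1$ to $M_{1+\Lambda}^\infty$. Viewed as a map from $M_\Lambda^1$ to $M_{1+\Lambda}^\infty$, and also viewed as a map from $M_\Lambda^1$ to $C$, it satisfies $\|V_\Lambda\|_e=\|V_\Lambda\|_{e,w}=\frac12$. -/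

import Mathlib

open MeasureTheory Set
open scoped NNReal unitInterval

noncomputable section

namespace MuntzSpace

/-! ### Müntz spaces on `[0, 1]`

`C([0,1])` is `C(I, 𝕜)` with the supremum norm, and `L¹([0,1])` is `Lp 𝕜 1 volume` for the Lebesgue
measure on the unit interval `I`. The scalars `𝕜` are the reals or the complex numbers. -/

/-- The monomial `x ↦ x ^ a` on `[0, 1]`, for a real exponent `a ≥ 0`. -/
def monomial (𝕜 : Type*) [RCLike 𝕜] (a : ℝ≥0) : C(I, 𝕜) where
  toFun x := (((x : ℝ) ^ (a : ℝ) : ℝ) : 𝕜)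
  continuous_toFun :=
    RCLike.continuous_ofReal.comp
      (continuous_subtype_val.rpow_const fun _ => Or.inr a.coe_nonneg)

/-- The Müntz condition `∑ 1 / λ < ∞`, the sum being over the nonzero `λ` in the sequence
(a term with `λ = 0` contributes `1 / 0 = 0`). -/
def MuntzCondition (Λ : ℕ → ℝ≥0) : Prop :=
  Summable fun k => 1 / (Λ k : ℝ)

/-- `M_Λ`: the linear span of the monomials `x ^ λ`, `λ ∈ Λ`. -/
def muntzSpan (𝕜 : Type*) [RCLike 𝕜] (Λ : ℕ → ℝ≥0) : Submodule 𝕜 C(I, 𝕜) :=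
  Submodule.span 𝕜 (range fun k => monomial 𝕜 (Λ k))

/-- `M_Λ^∞`: the closure of `M_Λ` in `C([0,1])`. -/
def muntzC (𝕜 : Type*) [RCLike 𝕜] (Λ : ℕ → ℝ≥0) : Submodule 𝕜 C(I, 𝕜) :=
  (muntzSpan 𝕜 Λ).topologicalClosure

/-- `M_Λ^1`: the closure of `M_Λ` in `L¹([0,1])`. -/
def muntzL1 (𝕜 : Type*) [RCLike 𝕜] (Λ : ℕ → ℝ≥0) :
    Submodule 𝕜 (Lp 𝕜 1 (volume : Measure I)) :=
  ((muntzSpan 𝕜 Λ).map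
    (ContinuousMap.toLp (E := 𝕜) 1 (volume : Measure I) 𝕜).toLinearMap).topologicalClosure

/-! ### Volterra and Cesàro transforms -/

/-- The Volterra transform `V f (x) = ∫₀ˣ f(t) dt`. -/
def volterra {𝕜 : Type*} [RCLike 𝕜] (f : Lp 𝕜 1 (volume : Measure I)) (x : I) : 𝕜 :=
  ∫ t in Iic x, f t

/-- `g` is the Cesàro transform of the class `f`: `g x = (1/x) ∫₀ˣ f(t) dt` for `0 < x ≤ 1`, and
`g 0 = f(0)`, where `f(0)` is the value at `0` of the representative of `f` which is continuous on
`[0, 1)`. (Such a representative is unique on `[0, 1)`; that it exists is part of the assertion.) -/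
def IsCesaroTransform {𝕜 : Type*} [RCLike 𝕜] (f : Lp 𝕜 1 (volume : Measure I))
    (g : C(I, 𝕜)) : Prop :=
  (∀ x : I, x ≠ 0 → g x = (((x : ℝ)⁻¹ : ℝ) : 𝕜) * volterra f x) ∧
    ∃ f₀ : I → 𝕜, ContinuousOn f₀ (Iio 1) ∧ f₀ =ᵐ[volume] f ∧ g 0 = f₀ 0

/-! ### Essential norms -/

/-- A bounded operator is weakly compact if the image of the closed unit ball is relatively compact
for the weak topology of the target space. -/
def IsWeaklyCompactOperator (𝕜 X Y : Type*) [RCLike 𝕜] [NormedAddCommGroup X] [NormedSpace 𝕜 X]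
    [NormedAddCommGroup Y] [NormedSpace 𝕜 Y] (T : X →L[𝕜] Y) : Prop :=
  IsCompact (closure (toWeakSpace 𝕜 Y '' (T '' Metric.closedBall 0 1)))

/-- `‖T‖_e` for `T : X → Y`: the distance, in operator norm, from `T` to the compact operators
from `X` to `Y`. -/
def essNorm (𝕜 X Y : Type*) [RCLike 𝕜] [NormedAddCommGroup X] [NormedSpace 𝕜 X]
    [NormedAddCommGroup Y] [NormedSpace 𝕜 Y] (T : X →L[𝕜] Y) : ℝ :=
  Metric.infDist T {S : X →L[𝕜] Y | IsCompactOperator S}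

/-- `‖T‖_{e,w}` for `T : X → Y`: the distance, in operator norm, from `T` to the weakly compact
operators from `X` to `Y`. -/
def weakEssNorm (𝕜 X Y : Type*) [RCLike 𝕜] [NormedAddCommGroup X] [NormedSpace 𝕜 X]
    [NormedAddCommGroup Y] [NormedSpace 𝕜 Y] (T : X →L[𝕜] Y) : ℝ :=
  Metric.infDist T {S : X →L[𝕜] Y | IsWeaklyCompactOperator 𝕜 X Y S}

end MuntzSpace

end

noncomputable section

namespace MuntzSpace

section

/-! ### The quadratic form of a Cauchy matrix -/

/-! The value 1/2 comes from the endpoint 1. Both operators send the normalized monomials, which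
have norm at most 1, to functions that equal 1 at 1 and tend to 0 pointwise on [0, 1). If S is
weakly compact and ‖T − S‖ = c, a weak cluster point g of the images under S is continuous and
satisfies |g| ≤ c on [0, 1), hence |g(1)| ≤ c, while |1 − g(1)| ≤ c; so c ≥ 1/2
(`half_le_norm_sub`).

For the upper bound let T be either operator and F the Volterra operator, to which T is close near
1. For r ≤ x the two increments of F f over [r, x] and [x, 1] have total size at most ‖f‖
(`norm_volterra_sub_add_le`). Approximate T f(x) by T f(r x) plus half the jump T f(1) − T f(r)
times a monomial e. Near 1 the error is about half the difference of the two increments; far from 1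
it is about half the jump: at most about 1/2 in both zones. Only an intermediate zone is
uncontrolled. Taking successive r closer to 1 makes these zones disjoint, and averaging N
approximants dilutes their cost to 3‖T‖ / N (`IsVolterraLike.exists_sum_compactApprox`). Dilations
and monomials stay inside the Müntz space, so the same approximants serve for both target spaces.

Boundedness of the Cesàro operator and compactness of the approximants rest on pointwise control of
Müntz polynomials on [0, r], r < 1, by their L¹ norm (`exists_muntzSpan_bound`). With F the
primitive of f and x = exp (−s), the function x F(x) is an exponential sum φ(s) whose L²(ds) norm is
at most ‖f‖₁ and is given by a Cauchy matrix. Peeling off Blaschke factors bounds the Laplace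
transform of φ in the left half-plane by a Blaschke product (`norm_sum_div_sq_le`), which grows more
slowly than any exponential on the contour because ∑ 1/λ converges (`exists_prod_one_add_le`).
Laplace inversion along two rays then recovers x² f(x) = −(φ + φ') (`exists_exp_sum_bound`). A
constant term is bounded directly through the Cauchy form (`exists_abs_constant_le`). -/

/-- The square of the `L²(0, ∞)` norm of `∑ a k * exp (-q k * s)`. -/
def cauchyForm (S : Finset ℕ) (q a : ℕ → ℝ) : ℝ :=
  ∑ i ∈ S, ∑ j ∈ S, a i * a j / (q i + q j)

/-- Orthogonal splitting in the Hardy space: a combination of the kernels 1/(z + q k) is the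
Blaschke factor (z − q p)/(z + q p) times a combination without p, plus a multiple of 1/(z + q p).
Multiplication by the factor is isometric, and 1/(z + q p) has squared norm 1/(2 q p). -/
theorem cauchyForm_insert {S : Finset ℕ} {p : ℕ} (hp : p ∉ S) {q : ℕ → ℝ}
    (hq : ∀ k, 0 < q k) (a : ℕ → ℝ) :
    cauchyForm (insert p S) q a =
      cauchyForm S q (fun k => a k * ((q k - q p) / (q k + q p))) +
        (a p + ∑ k ∈ S, 2 * q p * a k / (q k + q p)) ^ 2 / (2 * q p) := by
  have hpp : q p ≠ 0 := (hq p).ne'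
  have h1 : cauchyForm S q a = cauchyForm S q (fun k => a k * ((q k - q p) / (q k + q p))) +
      (∑ k ∈ S, 2 * q p * a k / (q k + q p)) ^ 2 / (2 * q p) := by
    rw [sq, Finset.sum_mul_sum, Finset.sum_div, cauchyForm, cauchyForm,
      ← Finset.sum_add_distrib]
    refine Finset.sum_congr rfl fun i _ => ?_
    rw [Finset.sum_div, ← Finset.sum_add_distrib]
    refine Finset.sum_congr rfl fun j _ => ?_
    have := (add_pos (hq i) (hq j)).ne'
    have := (add_pos (hq i) (hq p)).ne'
    have := (add_pos (hq j) (hq p)).ne'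
    field_simp
    ring
  have h2 : cauchyForm (insert p S) q a = a p ^ 2 / (2 * q p) +
      2 * a p * (∑ k ∈ S, 2 * q p * a k / (q k + q p)) / (2 * q p) + cauchyForm S q a := by
    rw [cauchyForm, Finset.sum_insert hp, Finset.sum_insert hp]
    simp_rw [Finset.sum_insert hp]
    rw [Finset.sum_add_distrib, ← cauchyForm]
    have e1 : ∑ x ∈ S, a p * a x / (q p + q x) =
        a p * (∑ k ∈ S, 2 * q p * a k / (q k + q p)) / (2 * q p) := by
      rw [Finset.mul_sum, Finset.sum_div]
      refine Finset.sum_congr rfl fun i _ => ?_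
      have := (add_pos (hq i) (hq p)).ne'
      rw [add_comm (q p)]
      field_simp
    have e2 : ∑ x ∈ S, a x * a p / (q x + q p) = ∑ x ∈ S, a p * a x / (q p + q x) :=
      Finset.sum_congr rfl fun i _ => by rw [mul_comm, add_comm]
    rw [e2, e1]
    field_simp
    ring
  rw [h2, h1]
  field_simp
  ring

theorem cauchyForm_nonneg (S : Finset ℕ) {q : ℕ → ℝ} (hq : ∀ k, 0 < q k) (a : ℕ → ℝ) :
    0 ≤ cauchyForm S q a := by
  induction S using Finset.induction_on generalizing a with
  | empty => simp [cauchyForm]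
  | insert p S hp ih =>
    rw [cauchyForm_insert hp hq]
    have := ih (fun k => a k * ((q k - q p) / (q k + q p)))
    have := hq p
    positivity

/-- The same splitting as in `cauchyForm_insert`, read on Laplace transforms. -/
theorem sum_div_insert {S : Finset ℕ} {p : ℕ} (hp : p ∉ S) {q : ℕ → ℝ}
    (hq : ∀ k, 0 < q k) (a : ℕ → ℝ) {z : ℂ} (hz : ∀ k, z + q k ≠ 0) :
    ∑ k ∈ insert p S, (a k : ℂ) / (z + q k) =
      (z - q p) / (z + q p) *
        ∑ k ∈ S, ((a k * ((q k - q p) / (q k + q p)) : ℝ) : ℂ) / (z + q k) +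
      ((a p + ∑ k ∈ S, 2 * q p * a k / (q k + q p) : ℝ) : ℂ) / (z + q p) := by
  rw [Finset.sum_insert hp]
  push_cast
  rw [add_div, Finset.mul_sum, Finset.sum_div, add_left_comm, ← Finset.sum_add_distrib]
  congr 1
  refine Finset.sum_congr rfl fun k _ => ?_
  have h1 := hz k
  have h2 := hz p
  have h3 : (q k : ℂ) + q p ≠ 0 := by exact_mod_cast (add_pos (hq k) (hq p)).ne'
  field_simp
  ring

/-- Cauchy–Schwarz in the plane for (√u, √v) and (√Q, √E). -/
theorem sq_add_le_of_sq_le {A B u v Q E : ℝ} (hu : 0 ≤ u) (hv : 0 ≤ v) (hQ : 0 ≤ Q) (hE : 0 ≤ E)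
    (hA : A ^ 2 ≤ u * Q) (hB : B ^ 2 ≤ v * E) : (A + B) ^ 2 ≤ (u + v) * (Q + E) := by
  have h : (2 * (A * B)) ^ 2 ≤ (u * E + v * Q) ^ 2 := by
    have : A ^ 2 * B ^ 2 ≤ (u * Q) * (v * E) := by gcongr
    nlinarith [sq_nonneg (u * E - v * Q)]
  have h2 : 2 * (A * B) ≤ u * E + v * Q := abs_le_of_sq_le_sq' h (by positivity) |>.2
  nlinarith

/-- The Laplace transform of `φ = ∑ a k * exp (-q k * s)`, continued to the left half-plane, is
controlled by the `L²` norm of `φ`. -/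
theorem norm_sum_div_sq_le (S : Finset ℕ) {q : ℕ → ℝ} (hq : ∀ k, 0 < q k) (a : ℕ → ℝ) {z : ℂ}
    (hre : z.re < 0) (hz : ∀ k, z + q k ≠ 0) :
    ‖∑ k ∈ S, (a k : ℂ) / (z + q k)‖ ^ 2 * (2 * -z.re) ≤
      ((∏ k ∈ S, (‖z - q k‖ / ‖z + q k‖) ^ 2) - 1) * cauchyForm S q a := by
  -- Since |z − q|² − |z + q|² = −4 q Re z, every Blaschke factor has modulus above 1 in the left
  -- half-plane.
  have hR : ∀ k, (‖z - q k‖ / ‖z + q k‖) ^ 2 = 1 + 2 * q k * (2 * -z.re) / ‖z + q k‖ ^ 2 := by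
    intro k
    have h1 : ‖z + q k‖ ^ 2 ≠ 0 := by simpa using hz k
    rw [div_pow, div_eq_iff h1, add_mul, div_mul_cancel₀ _ h1, ← Complex.normSq_eq_norm_sq,
      ← Complex.normSq_eq_norm_sq, Complex.normSq_apply, Complex.normSq_apply]
    simp
    ring
  have hP : ∀ S : Finset ℕ, 1 ≤ ∏ k ∈ S, (‖z - q k‖ / ‖z + q k‖) ^ 2 := by
    intro S
    refine Finset.prod_induction _ (1 ≤ ·) (fun _ _ => one_le_mul_of_one_le_of_one_le) le_rfl ?_
    intro k _
    have := hq k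
    have : 0 < 2 * -z.re := by linarith
    rw [hR, le_add_iff_nonneg_right]
    positivity
  induction S using Finset.induction_on generalizing a with
  | empty => simp
  | insert p S hp ih =>
    have ih' := ih (fun k => a k * ((q k - q p) / (q k + q p)))
    rw [sum_div_insert hp hq a hz, cauchyForm_insert hp hq, Finset.prod_insert hp]
    set X := ∑ k ∈ S, ((a k * ((q k - q p) / (q k + q p)) : ℝ) : ℂ) / (z + q k)
    set c := a p + ∑ k ∈ S, 2 * q p * a k / (q k + q p)
    set Q := cauchyForm S q (fun k => a k * ((q k - q p) / (q k + q p))) with hQdef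
    have hQ : 0 ≤ Q := cauchyForm_nonneg S hq _
    set P := ∏ k ∈ S, (‖z - q k‖ / ‖z + q k‖) ^ 2
    have hP1 : 0 ≤ P - 1 := sub_nonneg.2 (hP S)
    set R := ‖z - q p‖ / ‖z + q p‖ with hRdef
    have hR2 := hR p
    have ht : 0 < 2 * -z.re := by linarith
    set t := 2 * -z.re
    have hN : 0 < ‖z + q p‖ := by simpa using hz p
    have hqp := hq p
    have hle : ‖(z - q p) / (z + q p) * X + (c : ℂ) / (z + q p)‖ ≤ R * ‖X‖ + |c| / ‖z + q p‖ := by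
      refine (norm_add_le _ _).trans ?_
      rw [norm_mul, norm_div, norm_div, Complex.norm_real, Real.norm_eq_abs]
    -- The weights u and v are chosen to add up to R² P − 1, the constant for `insert p S`; Q and E
    -- add up to its Cauchy form.
    have key := sq_add_le_of_sq_le (A := R * ‖X‖ * √t) (B := |c| / ‖z + q p‖ * √t)
      (u := R ^ 2 * (P - 1)) (v := 2 * q p * t / ‖z + q p‖ ^ 2) (Q := Q) (E := c ^ 2 / (2 * q p))
      (by positivity) (by positivity) hQ (by positivity)
      (by
        rw [mul_pow, mul_pow, Real.sq_sqrt ht.le]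
        nlinarith [sq_nonneg R])
      (by
        rw [mul_pow, Real.sq_sqrt ht.le, div_pow, sq_abs]
        refine le_of_eq ?_
        field_simp)
    rw [← add_mul, mul_pow, Real.sq_sqrt ht.le] at key
    have e : R ^ 2 * P - 1 = R ^ 2 * (P - 1) + 2 * q p * t / ‖z + q p‖ ^ 2 := by
      rw [mul_sub, mul_one, hR2]; ring
    rw [e]
    refine le_trans ?_ key
    gcongr

/-- This bounds below the distance from one exponential to the span of the others. Peeling off k ∈ S
multiplies a i by (q i − q k)/(q i + q k) and drops a square; only the term of index i is left. -/
theorem sq_mul_prod_le_cauchyForm (S : Finset ℕ) {q : ℕ → ℝ} (hq : ∀ k, 0 < q k) (a : ℕ → ℝ)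
    {i : ℕ} (hi : i ∉ S) :
    a i ^ 2 / (2 * q i) * ∏ k ∈ S, ((q i - q k) / (q i + q k)) ^ 2 ≤
      cauchyForm (insert i S) q a := by
  induction S using Finset.induction_on generalizing a with
  | empty =>
    simp [cauchyForm]
    rw [← two_mul, sq]
  | insert p S hp ih =>
    have hip : i ≠ p := by rintro rfl; simp at hi
    have hiS : i ∉ S := fun h => hi (Finset.mem_insert_of_mem h)
    have := ih (fun k => a k * ((q k - q p) / (q k + q p))) hiS
    rw [Finset.insert_comm, cauchyForm_insert (by simp [hip.symm, hp]) hq, Finset.prod_insert hp]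
    have hqp := hq p
    refine le_trans (le_of_eq ?_) (this.trans (le_add_of_nonneg_right (by positivity)))
    ring

end

section

/-! ### A contour integral for the exponential

The contour consists of the two rays from the origin with directions `ω = -1 + i` and `conj ω`. -/

/-- The direction of the upper ray of the contour. -/
def rayDir : ℂ := ⟨-1, 1⟩

theorem normSq_ray_add (ρ q : ℝ) : ‖(ρ : ℂ) * rayDir + q‖ ^ 2 = (q - ρ) ^ 2 + ρ ^ 2 := by
  rw [← Complex.normSq_eq_norm_sq, Complex.normSq_apply]
  simp [rayDir]
  ring

/-- The distance from −q to the line through `rayDir` is |q|/√2. -/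
theorem le_norm_ray_add {ρ q : ℝ} : q ≤ 2 * ‖(ρ : ℂ) * rayDir + q‖ := by
  refine abs_le_of_sq_le_sq' ?_ (by positivity) |>.2
  rw [mul_pow, normSq_ray_add]
  nlinarith [sq_nonneg (2 * ρ - q), sq_nonneg q]

theorem le_norm_ray_add' {ρ q : ℝ} : ρ ≤ ‖(ρ : ℂ) * rayDir + q‖ := by
  refine abs_le_of_sq_le_sq' ?_ (by positivity) |>.2
  rw [normSq_ray_add]
  nlinarith [sq_nonneg (ρ - q)]

theorem ray_add_ne_zero {ρ q : ℝ} (hq : 0 < q) : (ρ : ℂ) * rayDir + q ≠ 0 := by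
  rw [← norm_pos_iff]
  linarith [@le_norm_ray_add ρ q]

theorem norm_rayDir_le : ‖rayDir‖ ≤ 2 := by
  have h : ‖rayDir‖ ^ 2 = 2 := by
    have := normSq_ray_add 1 0
    norm_num at this
    exact this
  nlinarith [norm_nonneg rayDir]

theorem rayDir_ne_zero : rayDir ≠ 0 := by
  intro h
  simpa [rayDir] using congrArg Complex.im h

theorem norm_exp_ray (ρ y : ℝ) : ‖Complex.exp ((ρ : ℂ) * rayDir * y)‖ = Real.exp (-(ρ * y)) := by
  rw [Complex.norm_exp]
  simp [rayDir]

/-- The integrand over the upper ray. -/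
def rayKernel (q y ρ : ℝ) : ℂ :=
  Complex.exp ((ρ : ℂ) * rayDir * y) * rayDir / ((ρ : ℂ) * rayDir + q)

theorem continuous_rayKernel {q : ℝ} (hq : 0 < q) (y : ℝ) : Continuous (rayKernel q y) := by
  unfold rayKernel
  exact Continuous.div (by fun_prop) (by fun_prop) fun ρ => ray_add_ne_zero hq

theorem norm_rayKernel_le {q : ℝ} (hq : 0 < q) (y ρ : ℝ) :
    ‖rayKernel q y ρ‖ ≤ 4 / q * Real.exp (-(ρ * y)) := by
  rw [rayKernel, norm_div, norm_mul, norm_exp_ray]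
  have h1 := @le_norm_ray_add ρ q
  have h2 : 0 < ‖(ρ : ℂ) * rayDir + q‖ := by linarith
  rw [div_le_iff₀ h2]
  have h3 : 2 ≤ 4 / q * ‖(ρ : ℂ) * rayDir + q‖ := by
    rw [div_mul_eq_mul_div, le_div_iff₀ hq]; linarith
  have := norm_rayDir_le
  have := Real.exp_pos (-(ρ * y))
  calc Real.exp (-(ρ * y)) * ‖rayDir‖ ≤ Real.exp (-(ρ * y)) * 2 := by gcongr
    _ ≤ Real.exp (-(ρ * y)) * (4 / q * ‖(ρ : ℂ) * rayDir + q‖) := by gcongr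
    _ = _ := by ring

theorem integrableOn_exp_neg_mul {y : ℝ} (hy : 0 < y) :
    IntegrableOn (fun ρ : ℝ => Real.exp (-(ρ * y))) (Ioi 0) := by
  have := exp_neg_integrableOn_Ioi 0 hy
  refine this.congr_fun (fun x _ => ?_) measurableSet_Ioi
  simp [mul_comm]

theorem integrableOn_rayKernel {q y : ℝ} (hq : 0 < q) (hy : 0 < y) :
    IntegrableOn (rayKernel q y) (Ioi 0) :=
  ((integrableOn_exp_neg_mul hy).const_mul (4 / q)).mono'
    (continuous_rayKernel hq y).aestronglyMeasurable
    (Filter.Eventually.of_forall fun ρ => norm_rayKernel_le hq y ρ)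

/-- What matters is that the value is real: such terms disappear when imaginary parts are taken,
which stands for adding the conjugate ray. -/
theorem integral_exp_ray {y : ℝ} (hy : 0 < y) :
    ∫ ρ in Ioi (0 : ℝ), Complex.exp ((ρ : ℂ) * rayDir * y) * rayDir = -(1 / y : ℝ) := by
  have := integral_exp_mul_complex_Ioi (a := rayDir * y) (by simp [rayDir, hy]) 0
  rw [integral_mul_const]
  have e : ∀ ρ : ℝ, Complex.exp ((ρ : ℂ) * rayDir * y) = Complex.exp (rayDir * y * ρ) := by
    intro ρ; congr 1; ring
  simp_rw [e, this]
  have := rayDir_ne_zero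
  have : (y : ℂ) ≠ 0 := by exact_mod_cast hy.ne'
  push_cast
  simp
  field_simp

/-- Multiplying by exp (q y) makes the y-derivative cancel the denominator, leaving the real
integral `integral_exp_ray`. -/
theorem hasDerivAt_integral_rayKernel {q y : ℝ} (hq : 0 < q) (hy : 0 < y) :
    HasDerivAt (fun y : ℝ => ∫ ρ in Ioi (0 : ℝ), Real.exp (q * y) * rayKernel q y ρ)
      ((-(Real.exp (q * y) / y) : ℝ) : ℂ) y := by
  have hexp : ∀ (y ρ : ℝ), (Real.exp (q * y) : ℂ) * rayKernel q y ρ =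
      Complex.exp (((ρ : ℂ) * rayDir + q) * y) * rayDir / ((ρ : ℂ) * rayDir + q) := by
    intro y ρ
    rw [rayKernel, add_mul, Complex.exp_add]
    push_cast
    ring
  have hint : ∫ ρ in Ioi (0 : ℝ), Complex.exp (((ρ : ℂ) * rayDir + q) * y) * rayDir =
      ((-(Real.exp (q * y) / y) : ℝ) : ℂ) := by
    have : ∀ ρ : ℝ, Complex.exp (((ρ : ℂ) * rayDir + q) * y) * rayDir =
        Real.exp (q * y) * (Complex.exp ((ρ : ℂ) * rayDir * y) * rayDir) := by
      intro ρ
      rw [add_mul, Complex.exp_add]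
      push_cast
      ring
    simp_rw [this]
    rw [integral_const_mul, integral_exp_ray hy]
    push_cast
    ring
  rw [← hint]
  refine (hasDerivAt_integral_of_dominated_loc_of_deriv_le (s := Ioo (y / 2) (2 * y))
    (F := fun (y ρ : ℝ) => (Real.exp (q * y) : ℂ) * rayKernel q y ρ)
    (F' := fun (y ρ : ℝ) => Complex.exp (((ρ : ℂ) * rayDir + q) * y) * rayDir)
    (bound := fun ρ => Real.exp (q * (2 * y)) * 2 * Real.exp (-(ρ * (y / 2))))
    (Ioo_mem_nhds (by linarith) (by linarith)) ?_ ?_ ?_ ?_ ?_ ?_).2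
  · exact Filter.Eventually.of_forall fun y =>
      ((continuous_rayKernel hq y).const_mul _).aestronglyMeasurable
  · exact (integrableOn_rayKernel hq hy).const_mul _
  · exact Continuous.aestronglyMeasurable (by fun_prop)
  · filter_upwards [ae_restrict_mem measurableSet_Ioi] with ρ (hρ : 0 < ρ) x hx
    rw [add_mul, Complex.exp_add, norm_mul, norm_mul, norm_exp_ray]
    have h1 : ‖Complex.exp ((q : ℂ) * x)‖ = Real.exp (q * x) := by
      rw [Complex.norm_exp]; simp
    rw [h1]
    have h2 : Real.exp (q * x) ≤ Real.exp (q * (2 * y)) := by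
      have := hx.2.le
      gcongr
    have h3 : Real.exp (-(ρ * x)) ≤ Real.exp (-(ρ * (y / 2))) := by
      have := hx.1.le
      gcongr
    calc Real.exp (-(ρ * x)) * Real.exp (q * x) * ‖rayDir‖
        ≤ Real.exp (-(ρ * (y / 2))) * Real.exp (q * (2 * y)) * 2 := by
          gcongr
          exact norm_rayDir_le
      _ = _ := by ring
  · exact (integrableOn_exp_neg_mul (by linarith : 0 < y / 2)).const_mul _
  · refine Filter.Eventually.of_forall fun ρ x _ => ?_
    simp_rw [hexp]
    have h := ray_add_ne_zero (ρ := ρ) hq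
    have h1 : HasDerivAt (fun x : ℝ => ((ρ : ℂ) * rayDir + q) * (x : ℂ))
        ((ρ : ℂ) * rayDir + q) x := by
      simpa using (Complex.ofRealCLM.hasDerivAt (x := x)).const_mul ((ρ : ℂ) * rayDir + q)
    refine ((h1.cexp.mul_const rayDir).div_const ((ρ : ℂ) * rayDir + q)).congr_deriv ?_
    field_simp

/-- A substitute for the residue theorem up to the constant A: a real derivative means a constant
imaginary part. -/
theorem exists_im_integral_rayKernel {q : ℝ} (hq : 0 < q) :
    ∃ A : ℝ, ∀ y, 0 < y → (∫ ρ in Ioi (0 : ℝ), rayKernel q y ρ).im = A * Real.exp (-(q * y)) := by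
  have hd : ∀ y ∈ Ioi (0 : ℝ), HasDerivAt
      (fun y : ℝ => (∫ ρ in Ioi (0 : ℝ), Real.exp (q * y) * rayKernel q y ρ).im) 0 y := by
    intro y hy
    have := (Complex.imCLM.hasFDerivAt.comp_hasDerivAt y (hasDerivAt_integral_rayKernel hq hy))
    have e : Complex.imCLM ((-(Real.exp (q * y) / y) : ℝ) : ℂ) = 0 := by
      rw [Complex.imCLM_apply, Complex.ofReal_im]
    rw [e] at this
    exact this
  obtain ⟨A, hA⟩ := isOpen_Ioi.exists_is_const_of_deriv_eq_zero (isPreconnected_Ioi)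
    (fun y hy => (hd y hy).differentiableAt.differentiableWithinAt) (fun y hy => (hd y hy).deriv)
  refine ⟨A, fun y hy => ?_⟩
  have := hA y hy
  simp only [integral_const_mul, Complex.im_ofReal_mul] at this
  rw [← this, mul_comm, ← mul_assoc, ← Real.exp_add]
  simp

/-- The arctangents come from q⁴ + 4ρ⁴ = (q² − 2qρ + 2ρ²)(q² + 2qρ + 2ρ²). -/
theorem integral_rational {q : ℝ} (hq : 0 < q) :
    ∫ ρ in Ioi (0 : ℝ), (q ^ 2 + 2 * ρ ^ 2) / (q ^ 4 + 4 * ρ ^ 4) = Real.pi / (2 * q) := by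
  have hd : ∀ x ∈ Ici (0 : ℝ), HasDerivAt (fun ρ : ℝ => 1 / (2 * q) *
      (Real.arctan ((2 * ρ - q) / q) + Real.arctan ((2 * ρ + q) / q)))
      ((q ^ 2 + 2 * x ^ 2) / (q ^ 4 + 4 * x ^ 4)) x := by
    intro x _
    have h1 : HasDerivAt (fun ρ : ℝ => (2 * ρ - q) / q) (2 / q) x := by
      simpa using (((hasDerivAt_id x).const_mul 2).sub_const q).div_const q
    have h2 : HasDerivAt (fun ρ : ℝ => (2 * ρ + q) / q) (2 / q) x := by
      simpa using (((hasDerivAt_id x).const_mul 2).add_const q).div_const q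
    refine ((h1.arctan.add h2.arctan).const_mul (1 / (2 * q))).congr_deriv ?_
    have e1 : 1 + ((2 * x - q) / q) ^ 2 ≠ 0 := by positivity
    have e2 : 1 + ((2 * x + q) / q) ^ 2 ≠ 0 := by positivity
    have e3 : q ^ 4 + 4 * x ^ 4 ≠ 0 := by positivity
    have e4 : q ^ 2 + (2 * x - q) ^ 2 ≠ 0 := by positivity
    have e5 : q ^ 2 + (2 * x + q) ^ 2 ≠ 0 := by positivity
    field_simp
    ring
  have hlim : ∀ c : ℝ, Filter.Tendsto (fun ρ : ℝ => Real.arctan ((2 * ρ + c) / q))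
      Filter.atTop (nhds (Real.pi / 2)) := by
    intro c
    refine (Real.tendsto_arctan_atTop.mono_right nhdsWithin_le_nhds).comp ?_
    refine Filter.Tendsto.atTop_div_const hq ?_
    exact Filter.tendsto_atTop_add_const_right _ _
      (Filter.tendsto_id.const_mul_atTop (by norm_num))
  have := integral_Ioi_of_hasDerivAt_of_nonneg' hd (fun x _ => by positivity)
    (((hlim (-q)).add (hlim q)).const_mul (1 / (2 * q)))
  rw [this]
  have e1 : (2 * 0 - q) / q = -1 := by field_simp; ring
  have e2 : (2 * 0 + q) / q = 1 := by field_simp; ring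
  rw [e1, e2, Real.arctan_neg]
  field_simp
  ring

theorem integrableOn_rational {q : ℝ} (hq : 0 < q) :
    IntegrableOn (fun ρ : ℝ => 1 / ((q + ρ) * (q + ρ))) (Ioi (0 : ℝ)) := by
  have hd : ∀ x ∈ Ici (0 : ℝ), HasDerivAt (fun ρ : ℝ => -(q + ρ)⁻¹) (1 / ((q + x) * (q + x))) x := by
    intro x hx
    have hx' : q + x ≠ 0 := by have : 0 ≤ x := hx; positivity
    refine (((hasDerivAt_id x).const_add q).inv hx').neg.congr_deriv ?_
    simp
    field_simp
  refine integrableOn_Ioi_deriv_of_nonneg' (l := 0) hd (fun x hx => ?_) ?_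
  · have := mul_self_nonneg (q + x)
    positivity
  · have := (Filter.tendsto_atTop_add_const_left Filter.atTop q Filter.tendsto_id).inv_tendsto_atTop.neg
    simpa using this

/-- The contour integral of `exp (z * y) / (z + q)` is `2 * π * i * exp (-q * y)`. -/
theorem im_integral_rayKernel {q y : ℝ} (hq : 0 < q) (hy : 0 < y) :
    (∫ ρ in Ioi (0 : ℝ), rayKernel q y ρ).im = Real.pi * Real.exp (-(q * y)) := by
  obtain ⟨A, hA⟩ := exists_im_integral_rayKernel hq
  -- A is found by integrating against exp (−q y) dy: one side is A/(2q), and by Fubini the other is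
  -- the rational integral π/(2q).
  suffices A = Real.pi by rw [hA y hy, this]
  set μ := volume.restrict (Ioi (0 : ℝ))
  have hinner : ∀ ρ, 0 < ρ → ∫ y in Ioi (0 : ℝ), Real.exp (-(y * q)) * rayKernel q y ρ =
      rayDir / ((ρ : ℂ) * rayDir + q) / (q - ρ * rayDir) := by
    intro ρ hρ
    have h1 := integral_exp_mul_complex_Ioi (a := ρ * rayDir - q)
      (by simp [rayDir]; linarith) 0
    have e : ∀ y : ℝ, (Real.exp (-(y * q)) : ℂ) * rayKernel q y ρ =
        Complex.exp ((ρ * rayDir - q) * y) * (rayDir / ((ρ : ℂ) * rayDir + q)) := by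
      intro y
      rw [rayKernel, sub_mul, sub_eq_add_neg, Complex.exp_add]
      push_cast
      rw [mul_comm (q : ℂ)]
      ring
    simp_rw [e]
    rw [integral_mul_const, h1]
    simp only [Complex.ofReal_zero, mul_zero, Complex.exp_zero]
    rw [neg_div, ← div_neg, neg_sub]
    ring
  have hprod : Integrable (Function.uncurry fun (ρ y : ℝ) =>
      (Real.exp (-(y * q)) : ℂ) * rayKernel q y ρ) (μ.prod μ) := by
    have hcont : Continuous (Function.uncurry fun (ρ y : ℝ) =>
      (Real.exp (-(y * q)) : ℂ) * rayKernel q y ρ) := by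
      unfold rayKernel Function.uncurry
      refine Continuous.mul (by fun_prop) (Continuous.div (by fun_prop) (by fun_prop)
        fun p => ray_add_ne_zero hq)
    have hG : Integrable (Function.uncurry fun (ρ y : ℝ) =>
        6 / (q + ρ) * Real.exp (-(y * (q + ρ)))) (μ.prod μ) := by
      have hmeas : AEStronglyMeasurable (Function.uncurry fun (ρ y : ℝ) =>
          6 / (q + ρ) * Real.exp (-(y * (q + ρ)))) (μ.prod μ) := by
        refine Measurable.aestronglyMeasurable ?_
        unfold Function.uncurry
        fun_prop
      rw [integrable_prod_iff hmeas]
      constructor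
      · filter_upwards [ae_restrict_mem measurableSet_Ioi] with ρ (hρ : 0 < ρ)
        exact (integrableOn_exp_neg_mul (add_pos hq hρ)).const_mul (6 / (q + ρ))
      · refine ((integrableOn_rational hq).const_mul 6).congr ?_
        filter_upwards [ae_restrict_mem measurableSet_Ioi] with ρ (hρ : 0 < ρ)
        have hqρ := add_pos hq hρ
        simp only [Function.uncurry, norm_mul, Real.norm_eq_abs, Real.abs_exp]
        rw [integral_const_mul, abs_of_pos (by positivity)]
        have := integral_exp_mul_Ioi (a := -(q + ρ)) (by linarith) 0
        simp_rw [mul_comm _ (q + ρ), ← neg_mul]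
        rw [this, mul_zero, Real.exp_zero, neg_div_neg_eq]
        field_simp
    refine hG.mono' hcont.aestronglyMeasurable ?_
    rw [Measure.prod_restrict]
    filter_upwards [ae_restrict_mem (measurableSet_Ioi.prod measurableSet_Ioi)]
    rintro ⟨ρ, y⟩ ⟨hρ : 0 < ρ, hy : 0 < y⟩
    simp only [Function.uncurry, rayKernel]
    rw [norm_mul, norm_div, norm_mul, norm_exp_ray, Complex.norm_real, Real.norm_eq_abs,
      Real.abs_exp]
    have h1 := @le_norm_ray_add ρ q
    have h2 := @le_norm_ray_add' ρ q
    have h3 : 0 < ‖(ρ : ℂ) * rayDir + q‖ := by linarith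
    have h4 : ‖rayDir‖ / ‖(ρ : ℂ) * rayDir + q‖ ≤ 6 / (q + ρ) := by
      rw [div_le_div_iff₀ h3 (by positivity)]
      have := norm_rayDir_le
      nlinarith
    calc Real.exp (-(y * q)) * (Real.exp (-(ρ * y)) * ‖rayDir‖ / ‖(ρ : ℂ) * rayDir + q‖)
        = ‖rayDir‖ / ‖(ρ : ℂ) * rayDir + q‖ * Real.exp (-(y * (q + ρ))) := by
          rw [show -(y * (q + ρ)) = -(y * q) + -(ρ * y) by ring, Real.exp_add]; ring
      _ ≤ _ := by gcongr
  have hswap := integral_integral_swap hprod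
  have hl : ∫ ρ, ∫ y, (Real.exp (-(y * q)) : ℂ) * rayKernel q y ρ ∂μ ∂μ =
    ∫ ρ in Ioi (0 : ℝ), rayDir / ((ρ : ℂ) * rayDir + q) / (q - ρ * rayDir) :=
    setIntegral_congr_fun measurableSet_Ioi fun ρ hρ => hinner ρ hρ
  rw [hl] at hswap
  have hint : Integrable (fun ρ : ℝ => rayDir / ((ρ : ℂ) * rayDir + q) / (q - ρ * rayDir)) μ := by
    refine (hprod.integral_prod_left).congr ?_
    filter_upwards [ae_restrict_mem measurableSet_Ioi] with ρ hρ
    exact hinner ρ hρ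
  have hint2 : Integrable (fun y => ∫ ρ, (Real.exp (-(y * q)) : ℂ) * rayKernel q y ρ ∂μ) μ :=
    hprod.integral_prod_right
  have him := congrArg Complex.im hswap
  rw [← RCLike.im_eq_complex_im, ← integral_im hint] at him
  rw [← integral_im hint2] at him
  have e1 : ∀ ρ : ℝ, RCLike.im (rayDir / ((ρ : ℂ) * rayDir + q) / (q - ρ * rayDir)) =
      (q ^ 2 + 2 * ρ ^ 2) / (q ^ 4 + 4 * ρ ^ 4) := by
    intro ρ
    have h1 := ray_add_ne_zero (ρ := ρ) hq
    have h2 := ray_add_ne_zero (ρ := -ρ) hq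
    have hD : ((q ^ 4 + 4 * ρ ^ 4 : ℝ) : ℂ) ≠ 0 := by
      have : q ^ 4 + 4 * ρ ^ 4 ≠ 0 := by positivity
      exact_mod_cast this
    have hω : rayDir = -1 + Complex.I := by
      apply Complex.ext <;> simp [rayDir]
    have : rayDir / ((ρ : ℂ) * rayDir + q) / (q - ρ * rayDir) =
        (((2 * ρ ^ 2 - q ^ 2) / (q ^ 4 + 4 * ρ ^ 4) : ℝ) : ℂ) +
          (((q ^ 2 + 2 * ρ ^ 2) / (q ^ 4 + 4 * ρ ^ 4) : ℝ) : ℂ) * Complex.I := by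
      have h3 : (q : ℂ) - ρ * rayDir ≠ 0 := by
        intro h; apply h2; push_cast; rw [← h]; ring
      rw [div_div, div_eq_iff (mul_ne_zero h1 h3), Complex.ofReal_div, Complex.ofReal_div,
        div_mul_eq_mul_div, ← add_div, div_mul_eq_mul_div, eq_div_iff hD, hω]
      push_cast
      have := Complex.I_sq
      ring_nf
      have h3 : Complex.I ^ 3 = -Complex.I := Complex.I_pow_three
      rw [h3, Complex.I_sq]
      ring
    rw [this, RCLike.im_eq_complex_im, Complex.add_im, Complex.ofReal_im, Complex.im_ofReal_mul]
    simp
  simp_rw [e1] at him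
  rw [integral_rational hq] at him
  have e2 : ∫ y, RCLike.im (∫ ρ, (Real.exp (-(y * q)) : ℂ) * rayKernel q y ρ ∂μ) ∂μ =
      ∫ y in Ioi (0 : ℝ), A * Real.exp (-(y * (2 * q))) := by
    refine setIntegral_congr_fun measurableSet_Ioi fun y hy => ?_
    have := hA y hy
    simp only [integral_const_mul, RCLike.im_eq_complex_im, Complex.im_ofReal_mul]
    rw [this, mul_left_comm, ← Real.exp_add]
    congr 2
    ring
  rw [e2, integral_const_mul] at him
  have e3 : ∫ y in Ioi (0 : ℝ), Real.exp (-(y * (2 * q))) = 1 / (2 * q) := by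
    have := integral_exp_mul_Ioi (a := -(2 * q)) (by linarith) 0
    simp at this
    simp_rw [mul_comm _ (2 * q)]
    simp [this]
  rw [e3] at him
  field_simp at him
  linarith

end

section

/-! ### Pointwise bounds for real Müntz polynomials -/

/-- Trades a linear factor for an exponential of arbitrarily small rate τ, at the price of a
constant. -/
theorem one_add_mul_le_exp {u ρ τ : ℝ} (hu : 0 ≤ u) (hρ : 0 ≤ ρ) (hτ : 0 < τ) :
    1 + u * ρ ≤ (1 + u / τ) * Real.exp (τ * ρ) := by
  have h1 : τ * ρ ≤ Real.exp (τ * ρ) := by linarith [Real.add_one_le_exp (τ * ρ)]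
  have h2 : 1 ≤ Real.exp (τ * ρ) := Real.one_le_exp (by positivity)
  have h3 : u * ρ = u / τ * (τ * ρ) := by field_simp
  rw [h3, add_mul, one_mul]
  gcongr

/-- A product of genus zero has exponential type zero, uniformly over finite subproducts: the tail
is bounded through its small sum, and the finitely many remaining factors are absorbed one by one.
-/
theorem exists_prod_one_add_le {u : ℕ → ℝ} (hu : ∀ k, 0 ≤ u k) (hs : Summable u) {η : ℝ}
    (hη : 0 < η) :
    ∃ C : ℝ, 0 < C ∧ ∀ (S : Finset ℕ) (ρ : ℝ), 0 ≤ ρ →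
      ∏ k ∈ S, (1 + u k * ρ) ≤ C * Real.exp (η * ρ) := by
  obtain ⟨T, hT⟩ := summable_iff_vanishing_norm.1 hs (η / 2) (by linarith)
  -- With this rate the card T head factors together cost at most exp (η ρ / 2).
  set τ := η / (2 * (T.card + 1)) with hτdef
  have hτ : 0 < τ := by positivity
  refine ⟨∏ k ∈ T, (1 + u k / τ), Finset.prod_pos fun k _ => by have := hu k; positivity,
    fun S ρ hρ => ?_⟩
  have h1 : ∀ k, 1 ≤ 1 + u k * ρ := fun k => by
    have := mul_nonneg (hu k) hρ
    linarith
  have h2 : ∏ k ∈ S \ T, (1 + u k * ρ) ≤ Real.exp (η / 2 * ρ) := by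
    calc ∏ k ∈ S \ T, (1 + u k * ρ) ≤ ∏ k ∈ S \ T, Real.exp (u k * ρ) :=
          Finset.prod_le_prod (fun k _ => by linarith [h1 k])
            fun k _ => by linarith [Real.add_one_le_exp (u k * ρ)]
      _ = Real.exp ((∑ k ∈ S \ T, u k) * ρ) := by rw [← Real.exp_sum, Finset.sum_mul]
      _ ≤ Real.exp (η / 2 * ρ) := by
          gcongr
          have := hT (S \ T) Finset.sdiff_disjoint
          exact (le_abs_self _).trans this.le
  have h3 : ∏ k ∈ S ∩ T, (1 + u k * ρ) ≤ (∏ k ∈ T, (1 + u k / τ)) * Real.exp (η / 2 * ρ) := by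
    calc ∏ k ∈ S ∩ T, (1 + u k * ρ) ≤ ∏ k ∈ T, (1 + u k * ρ) := by
          rw [← Finset.prod_sdiff (Finset.inter_subset_right : S ∩ T ⊆ T)]
          refine le_mul_of_one_le_left (Finset.prod_nonneg fun k _ => by linarith [h1 k]) ?_
          exact Finset.prod_induction _ (1 ≤ ·) (fun _ _ => one_le_mul_of_one_le_of_one_le) le_rfl
            fun k _ => h1 k
      _ ≤ ∏ k ∈ T, ((1 + u k / τ) * Real.exp (τ * ρ)) :=
          Finset.prod_le_prod (fun k _ => by linarith [h1 k])
            fun k _ => one_add_mul_le_exp (hu k) hρ hτ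
      _ = (∏ k ∈ T, (1 + u k / τ)) * Real.exp (T.card * (τ * ρ)) := by
          rw [Finset.prod_mul_distrib, Finset.prod_const, ← Real.exp_nat_mul]
      _ ≤ _ := by
          have : 0 ≤ ∏ k ∈ T, (1 + u k / τ) :=
            Finset.prod_nonneg fun k _ => by have := hu k; positivity
          gcongr ?_ * ?_
          apply Real.exp_le_exp.2
          rw [← mul_assoc]
          gcongr
          rw [hτdef, mul_div_assoc', div_le_div_iff₀ (by positivity) (by norm_num)]
          nlinarith
  calc ∏ k ∈ S, (1 + u k * ρ)
      = (∏ k ∈ S ∩ T, (1 + u k * ρ)) * ∏ k ∈ S \ T, (1 + u k * ρ) :=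
        (Finset.prod_inter_mul_prod_sdiff S T _).symm
    _ ≤ ((∏ k ∈ T, (1 + u k / τ)) * Real.exp (η / 2 * ρ)) * Real.exp (η / 2 * ρ) := by
        refine mul_le_mul h3 h2 (Finset.prod_nonneg fun k _ => by linarith [h1 k]) ?_
        exact mul_nonneg (Finset.prod_nonneg fun k _ => by have := hu k; positivity)
          (Real.exp_nonneg _)
    _ = _ := by
        rw [mul_assoc, ← Real.exp_add]
        congr 2
        ring

/-- Laplace inversion along the rays from −c. The transform of the sum is bounded there by a
Blaschke product times √Q, and the decay exp (−ρ y) with y ≥ η beats the growth of that product.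
Shifting the vertex to −c produces the factor exp (−c y). -/
theorem exists_exp_sum_bound {q : ℕ → ℝ} {q₀ c η : ℝ} (hc : 0 < c) (hcq : c < q₀)
    (hq : ∀ k, q₀ ≤ q k) (hs : Summable fun k => 1 / q k) (hη : 0 < η) :
    ∃ C : ℝ, 0 ≤ C ∧ ∀ (S : Finset ℕ) (a : ℕ → ℝ) (y : ℝ), η ≤ y →
      |∑ k ∈ S, a k * (q k - 1) * Real.exp (-(q k * y))| ≤
        C * Real.exp (-(c * y)) * √(cauchyForm S q a) := by
  have hq0 : 0 < q₀ := hc.trans hcq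
  have hqpos : ∀ k, 0 < q k := fun k => hq0.trans_le (hq k)
  -- κ makes the gap q k − c between pole and vertex proportional to q k.
  set κ := 1 - c / q₀ with hκdef
  have hκ : 0 < κ := by rw [hκdef, sub_pos, div_lt_one hq0]; exact hcq
  have hqc : ∀ k, κ * q k ≤ q k - c := by
    intro k
    have : c ≤ c / q₀ * q k := by
      rw [div_mul_eq_mul_div, le_div_iff₀ hq0]
      have := hq k
      gcongr
    rw [hκdef]
    linarith
  have hqc' : ∀ k, 0 < q k - c := fun k => (mul_pos hκ (hqpos k)).trans_le (hqc k)
  -- The rate η/8 is used twice, at c + 2ρ, costing exp (η ρ / 2): half of the decay exp (−η ρ).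
  obtain ⟨C, hC, hprod⟩ := exists_prod_one_add_le (u := fun k => 4 / κ * (1 / q k))
    (fun k => by have := hqpos k; positivity) (hs.mul_left (4 / κ)) (η := η / 8) (by linarith)
  set D := 2 * ((1 + 1 / (η / 8)) * Real.exp (η / 4 * c)) * C / √(2 * c) with hDdef
  have hD : 0 ≤ D := by positivity
  refine ⟨D * (2 / η) / Real.pi, by positivity, fun S a y hy => ?_⟩
  have hy0 : 0 < y := hη.trans_le hy
  set Q := cauchyForm S q a
  have hQ : 0 ≤ Q := cauchyForm_nonneg S hqpos a
  set z : ℝ → ℂ := fun ρ => (ρ : ℂ) * rayDir - c with hzdef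
  have hzq : ∀ ρ k, z ρ + q k = (ρ : ℂ) * rayDir + ((q k - c : ℝ) : ℂ) := by
    intro ρ k
    simp only [hzdef]
    push_cast
    ring
  have hzne : ∀ ρ k, z ρ + q k ≠ 0 := fun ρ k => by
    rw [hzq]; exact ray_add_ne_zero (hqc' k)
  -- The factor z + 1 gives the residue a k (1 − q k) exp (−q k y) at −q k, up to the shift by c,
  -- and splits off a constant whose integral is real.
  set G : ℝ → ℂ := fun ρ => Complex.exp ((ρ : ℂ) * rayDir * y) * rayDir * (z ρ + 1) *
    ∑ k ∈ S, (a k : ℂ) / (z ρ + q k) with hGdef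
  have hG : ∀ ρ, G ρ = (∑ k ∈ S, (a k : ℂ)) * (Complex.exp ((ρ : ℂ) * rayDir * y) * rayDir) -
      ∑ k ∈ S, ((a k * (q k - 1) : ℝ) : ℂ) * rayKernel (q k - c) y ρ := by
    intro ρ
    simp only [hGdef, rayKernel]
    rw [Finset.mul_sum, Finset.sum_mul, ← Finset.sum_sub_distrib]
    refine Finset.sum_congr rfl fun k _ => ?_
    rw [← hzq]
    have := hzne ρ k
    push_cast
    field_simp
    ring
  have hexpint : IntegrableOn (fun ρ : ℝ => Complex.exp ((ρ : ℂ) * rayDir * y) * rayDir)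
      (Ioi 0) := by
    refine ((integrableOn_exp_neg_mul hy0).mul_const ‖rayDir‖).mono'
      (Continuous.aestronglyMeasurable (by fun_prop)) (Filter.Eventually.of_forall fun ρ => ?_)
    rw [norm_mul, norm_exp_ray]
  have hintG : ∫ ρ in Ioi (0 : ℝ), G ρ = (∑ k ∈ S, (a k : ℂ)) * (-(1 / y : ℝ)) -
      ∑ k ∈ S, ((a k * (q k - 1) : ℝ) : ℂ) * ∫ ρ in Ioi (0 : ℝ), rayKernel (q k - c) y ρ := by
    simp_rw [hG]
    rw [integral_sub (hexpint.const_mul _)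
      (integrable_finsetSum _ fun k _ => (integrableOn_rayKernel (hqc' k) hy0).const_mul _),
      integral_const_mul, integral_exp_ray hy0,
      integral_finsetSum _ fun k _ => (integrableOn_rayKernel (hqc' k) hy0).const_mul _]
    simp_rw [integral_const_mul]
  have him : (∫ ρ in Ioi (0 : ℝ), G ρ).im =
      -(Real.pi * Real.exp (c * y) * ∑ k ∈ S, a k * (q k - 1) * Real.exp (-(q k * y))) := by
    have e1 : (∑ k ∈ S, (a k : ℂ)) * (-(1 / y : ℝ)) =
        (((∑ k ∈ S, a k) * (-(1 / y)) : ℝ) : ℂ) := by push_cast; rfl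
    rw [hintG, e1, Complex.sub_im, Complex.ofReal_im, zero_sub, Complex.im_sum, Finset.mul_sum]
    congr 1
    refine Finset.sum_congr rfl fun k _ => ?_
    rw [Complex.im_ofReal_mul, im_integral_rayKernel (hqc' k) hy0,
      show -((q k - c) * y) = c * y + -(q k * y) by ring, Real.exp_add]
    ring
  have hbound : ∀ ρ, 0 < ρ → ‖G ρ‖ ≤ D * √Q * Real.exp (-(ρ * (η / 2))) := by
    intro ρ hρ
    have hre : (z ρ).re = -(ρ + c) := by simp [hzdef, rayDir]; ring
    have hz1 : ‖z ρ‖ ≤ c + 2 * ρ := by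
      refine (norm_sub_le _ _).trans ?_
      rw [norm_mul, Complex.norm_real, Complex.norm_real, Real.norm_eq_abs, Real.norm_eq_abs,
        abs_of_pos hρ, abs_of_pos hc]
      nlinarith [norm_rayDir_le]
    have h1 := norm_sum_div_sq_le S hqpos a (z := z ρ) (by rw [hre]; linarith) (hzne ρ)
    rw [hre, neg_neg, Finset.prod_pow] at h1
    set P := ∏ k ∈ S, (‖z ρ - q k‖ / ‖z ρ + q k‖)
    have hP0 : 0 ≤ P := Finset.prod_nonneg fun k _ => by positivity
    have hP : P ≤ C * Real.exp (η / 8 * (c + 2 * ρ)) := by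
      refine (Finset.prod_le_prod (fun k _ => by positivity) fun k _ => ?_).trans
        (hprod S (c + 2 * ρ) (by positivity))
      have h3 : 0 < ‖z ρ + q k‖ := norm_pos_iff.2 (hzne ρ k)
      have h4 : κ * q k ≤ 2 * ‖z ρ + q k‖ := by
        rw [hzq]; exact (hqc k).trans le_norm_ray_add
      -- Hence the Blaschke factor is at most 1 + 2‖z‖ / ‖z + q k‖, and ‖z + q k‖ is at least a
      -- multiple of q k.
      have h5 : ‖z ρ - q k‖ ≤ 2 * ‖z ρ‖ + ‖z ρ + q k‖ := by
        have : z ρ - q k = 2 * z ρ - (z ρ + q k) := by ring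
        rw [this]
        refine (norm_sub_le _ _).trans ?_
        rw [norm_mul]; simp
      rw [div_le_iff₀ h3]
      have hqk := hqpos k
      have h6 : 2 ≤ 4 / κ * (1 / q k) * ‖z ρ + q k‖ := by
        have : 4 / κ * (1 / q k) * ‖z ρ + q k‖ = 4 * ‖z ρ + q k‖ / (κ * q k) := by field_simp
        rw [this, le_div_iff₀ (by positivity)]
        linarith
      have h7 : 2 * (c + 2 * ρ) ≤ 4 / κ * (1 / q k) * ‖z ρ + q k‖ * (c + 2 * ρ) := by gcongr
      calc ‖z ρ - q k‖ ≤ 2 * (c + 2 * ρ) + ‖z ρ + q k‖ := by linarith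
        _ ≤ 4 / κ * (1 / q k) * ‖z ρ + q k‖ * (c + 2 * ρ) + ‖z ρ + q k‖ := by linarith
        _ = _ := by ring
    have h2 : ‖∑ k ∈ S, (a k : ℂ) / (z ρ + q k)‖ ≤ P * √Q / √(2 * c) := by
      rw [le_div_iff₀ (by positivity)]
      refine abs_le_of_sq_le_sq' ?_ (by positivity) |>.2
      rw [mul_pow, mul_pow, Real.sq_sqrt hQ, Real.sq_sqrt (by positivity)]
      calc _ ≤ ‖∑ k ∈ S, (a k : ℂ) / (z ρ + q k)‖ ^ 2 * (2 * (ρ + c)) := by gcongr; linarith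
        _ ≤ (P ^ 2 - 1) * Q := h1
        _ ≤ P ^ 2 * Q := by nlinarith
    have h3 : ‖z ρ + 1‖ ≤ (1 + 1 / (η / 8)) * Real.exp (η / 8 * (c + 2 * ρ)) := by
      have := one_add_mul_le_exp (u := 1) (ρ := c + 2 * ρ) (τ := η / 8) zero_le_one
        (by positivity) (by positivity)
      refine le_trans ((norm_add_le _ _).trans ?_) this
      rw [norm_one]
      linarith
    simp only [hGdef]
    rw [norm_mul, norm_mul, norm_mul, norm_exp_ray]
    calc Real.exp (-(ρ * y)) * ‖rayDir‖ * ‖z ρ + 1‖ * ‖∑ k ∈ S, (a k : ℂ) / (z ρ + q k)‖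
        ≤ Real.exp (-(ρ * η)) * 2 * ((1 + 1 / (η / 8)) * Real.exp (η / 8 * (c + 2 * ρ))) *
          (C * Real.exp (η / 8 * (c + 2 * ρ)) * √Q / √(2 * c)) := by
          gcongr
          · exact norm_rayDir_le
          · exact h2.trans (by gcongr)
      _ = D * √Q * Real.exp (-(ρ * (η / 2))) := by
          have e : Real.exp (-(ρ * η)) * Real.exp (η / 8 * (c + 2 * ρ)) *
              Real.exp (η / 8 * (c + 2 * ρ)) =
              Real.exp (η / 4 * c) * Real.exp (-(ρ * (η / 2))) := by
            rw [← Real.exp_add, ← Real.exp_add, ← Real.exp_add]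
            congr 1
            ring
          rw [hDdef]
          linear_combination (2 * (1 + 1 / (η / 8)) * C * √Q / √(2 * c)) * e
  have hnorm : ‖∫ ρ in Ioi (0 : ℝ), G ρ‖ ≤ D * √Q * (2 / η) := by
    have hη2 : 0 < η / 2 := by linarith
    refine (norm_integral_le_of_norm_le ((integrableOn_exp_neg_mul hη2).const_mul (D * √Q))
      ?_).trans_eq ?_
    · filter_upwards [ae_restrict_mem measurableSet_Ioi] with ρ hρ
      exact hbound ρ hρ
    · have := integral_exp_mul_Ioi (a := -(η / 2)) (by linarith) 0
      rw [integral_const_mul]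
      simp_rw [mul_comm _ (η / 2), ← neg_mul]
      rw [this, mul_zero, Real.exp_zero, neg_div_neg_eq]
      simp
  have h1 := (Complex.abs_im_le_norm _).trans hnorm
  rw [him, abs_neg, abs_mul, abs_of_pos (by positivity)] at h1
  have e : Real.exp (-(c * y)) * Real.exp (c * y) = 1 := by rw [← Real.exp_add]; simp
  set X := |∑ k ∈ S, a k * (q k - 1) * Real.exp (-(q k * y))|
  calc X = (Real.pi * Real.exp (c * y) * X) * (Real.exp (-(c * y)) / Real.pi) := by
        have := Real.pi_pos
        rw [div_eq_mul_inv]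
        linear_combination (-X) * e * (Real.pi * Real.pi⁻¹) - X * (mul_inv_cancel₀ this.ne')
    _ ≤ D * √Q * (2 / η) * (Real.exp (-(c * y)) / Real.pi) := by gcongr
    _ = _ := by ring

end

section

/-! ### From exponential sums to real Müntz polynomials and their L¹ norm -/

theorem continuous_sum_rpow (S : Finset ℕ) (a : ℕ → ℝ) {l : ℕ → ℝ} (hl : ∀ k, 0 ≤ l k) :
    Continuous fun t : ℝ => ∑ k ∈ S, a k * t ^ l k :=
  continuous_finsetSum _ fun k _ => continuous_const.mul
    (Real.continuous_rpow_const (hl k))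

theorem integral_sum_rpow (S : Finset ℕ) (a : ℕ → ℝ) {l : ℕ → ℝ} (hl : ∀ k, 0 ≤ l k) (x : ℝ) :
    ∫ t in (0 : ℝ)..x, ∑ k ∈ S, a k * t ^ l k = ∑ k ∈ S, a k / (l k + 1) * x ^ (l k + 1) := by
  have hc : ∀ k, Continuous fun t : ℝ => a k * t ^ l k := fun k =>
    continuous_const.mul (Real.continuous_rpow_const (hl k))
  rw [intervalIntegral.integral_finsetSum fun k _ => (hc k).intervalIntegrable _ _]
  refine Finset.sum_congr rfl fun k _ => ?_
  have := hl k
  rw [intervalIntegral.integral_const_mul, integral_rpow (Or.inl (by linarith)),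
    Real.zero_rpow (by linarith)]
  ring

/-- With `F x = ∫₀ˣ f`, the quadratic form is the square of the `L²(dx / x)` norm of `x * F x`. -/
theorem cauchyForm_le_sq_integral (S : Finset ℕ) (a : ℕ → ℝ) {l : ℕ → ℝ} (hl : ∀ k, 0 ≤ l k) :
    cauchyForm S (fun k => l k + 2) (fun k => a k / (l k + 1)) ≤
      (∫ t in (0 : ℝ)..1, |∑ k ∈ S, a k * t ^ l k|) ^ 2 := by
  set f : ℝ → ℝ := fun t => ∑ k ∈ S, a k * t ^ l k with hf
  have hfc : Continuous f := continuous_sum_rpow S a hl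
  set N := ∫ t in (0 : ℝ)..1, |f t|
  set F : ℝ → ℝ := fun x => ∑ k ∈ S, a k / (l k + 1) * x ^ (l k + 1) with hF
  have hFc : Continuous F := continuous_sum_rpow S (fun k => a k / (l k + 1))
    (l := fun k => l k + 1) fun k => by linarith [hl k]
  have hFN : ∀ x ∈ Icc (0 : ℝ) 1, |F x| ≤ N := by
    intro x hx
    simp only [hF]
    rw [← integral_sum_rpow S a hl x]
    refine (intervalIntegral.abs_integral_le_integral_abs hx.1).trans ?_
    exact intervalIntegral.integral_mono_interval le_rfl hx.1 hx.2
      (Filter.Eventually.of_forall fun t => abs_nonneg _) (hfc.abs.intervalIntegrable _ _)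
  -- The exponent l i + l j + 3 of x F² integrates to 1/(l i + l j + 4), which is 1/(q i + q j) for
  -- q = l + 2.
  have hQ : cauchyForm S (fun k => l k + 2) (fun k => a k / (l k + 1)) =
      ∫ x in (0 : ℝ)..1, x * F x ^ 2 := by
    have e : ∀ x ∈ uIcc (0 : ℝ) 1, x * F x ^ 2 = ∑ i ∈ S, ∑ j ∈ S,
        (a i / (l i + 1)) * (a j / (l j + 1)) * x ^ (l i + l j + 3) := by
      intro x hx
      rw [uIcc_of_le zero_le_one] at hx
      rw [hF, sq, Finset.sum_mul_sum, Finset.mul_sum]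
      refine Finset.sum_congr rfl fun i _ => ?_
      rw [Finset.mul_sum]
      refine Finset.sum_congr rfl fun j _ => ?_
      have hi := hl i
      have hj := hl j
      have : x ^ (l i + l j + 3) = x * (x ^ (l i + 1) * x ^ (l j + 1)) := by
        rw [← Real.rpow_add_of_nonneg hx.1 (by linarith) (by linarith),
          ← Real.rpow_one_add' hx.1 (by linarith)]
        congr 1
        ring
      rw [this]
      ring
    have hc : ∀ i j, Continuous fun x : ℝ =>
        (a i / (l i + 1)) * (a j / (l j + 1)) * x ^ (l i + l j + 3) := fun i j =>
      continuous_const.mul (Real.continuous_rpow_const (by linarith [hl i, hl j]))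
    rw [intervalIntegral.integral_congr e, intervalIntegral.integral_finsetSum fun i _ =>
      (continuous_finsetSum _ fun j _ => hc i j).intervalIntegrable _ _, cauchyForm]
    refine Finset.sum_congr rfl fun i _ => ?_
    rw [intervalIntegral.integral_finsetSum fun j _ => (hc i j).intervalIntegrable _ _]
    refine Finset.sum_congr rfl fun j _ => ?_
    have hi := hl i
    have hj := hl j
    rw [intervalIntegral.integral_const_mul, integral_rpow (Or.inl (by linarith)),
      Real.zero_rpow (by linarith), Real.one_rpow, sub_zero, mul_one_div]
    congr 1
    ring
  rw [hQ]
  calc ∫ x in (0 : ℝ)..1, x * F x ^ 2 ≤ ∫ x in (0 : ℝ)..1, N ^ 2 := by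
        refine intervalIntegral.integral_mono_on zero_le_one
          ((continuous_id.mul (hFc.pow 2)).intervalIntegrable _ _)
          (continuous_const.intervalIntegrable _ _) fun x hx => ?_
        have : F x ^ 2 ≤ N ^ 2 := sq_le_sq.2 ((hFN x hx).trans (le_abs_self _))
        calc x * F x ^ 2 ≤ 1 * F x ^ 2 := by gcongr; exact hx.2
          _ ≤ N ^ 2 := by rwa [one_mul]
    _ = N ^ 2 := by simp

theorem summable_one_div_add {l : ℕ → ℝ} (hl : ∀ k, 0 ≤ l k) (hs : Summable fun k => 1 / l k)
    (hl' : ∀ k, 1 ≤ k → 0 < l k) :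
    Summable fun k => 1 / (l k + 2) := by
  rw [← summable_nat_add_iff 1] at hs ⊢
  refine Summable.of_nonneg_of_le (fun k => ?_) (fun k => ?_) hs
  · have := hl (k + 1)
    positivity
  · have := hl' (k + 1) (by simp)
    gcongr
    linarith

/-- A real Müntz polynomial with positive exponents is bounded away from `1` by its `L¹` norm. -/
theorem exists_abs_sum_rpow_le {l : ℕ → ℝ} {l₀ r : ℝ} (hl₀ : 0 < l₀) (hl : ∀ k, l₀ ≤ l k)
    (hs : Summable fun k => 1 / l k) (hr : r < 1) :
    ∃ C : ℝ, 0 ≤ C ∧ ∀ (S : Finset ℕ) (a : ℕ → ℝ) (x : ℝ), 0 ≤ x → x ≤ r →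
      |∑ k ∈ S, a k * x ^ l k| ≤ C * x ^ (l₀ / 2) * ∫ t in (0 : ℝ)..1, |∑ k ∈ S, a k * t ^ l k| := by
  have hlpos : ∀ k, 0 < l k := fun k => hl₀.trans_le (hl k)
  rcases le_or_gt r 0 with hr0 | hr0
  · refine ⟨0, le_rfl, fun S a x hx hxr => ?_⟩
    obtain rfl : x = 0 := le_antisymm (hxr.trans hr0) hx
    simp [Real.zero_rpow (hlpos _).ne']
  -- Substitute x = exp (−y). Since q − 1 = l + 1 cancels the denominators of the primitive, the
  -- exponential sum is x² f(x); the choice of c yields x ^ (l₀ / 2) · x², and x² cancels.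
  obtain ⟨C, hC, h⟩ := exists_exp_sum_bound (q := fun k => l k + 2) (q₀ := l₀ + 2)
    (c := l₀ / 2 + 2) (η := -Real.log r) (by positivity) (by linarith)
    (fun k => by linarith [hl k])
    (summable_one_div_add (fun k => (hlpos k).le) hs fun k _ => hlpos k)
    (by have := Real.log_neg hr0 hr; linarith)
  refine ⟨C, hC, fun S a x hx hxr => ?_⟩
  rcases hx.eq_or_lt with rfl | hx
  · simp [Real.zero_rpow (hlpos _).ne', Real.zero_rpow (half_pos hl₀).ne']
  have h1 := h S (fun k => a k / (l k + 1)) (-Real.log x) (by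
    have := Real.log_le_log hx hxr; linarith)
  have hexp : ∀ b : ℝ, Real.exp (-((b + 2) * -Real.log x)) = x ^ b * x ^ 2 := by
    intro b
    rw [mul_neg, neg_neg, mul_comm, ← Real.rpow_def_of_pos hx, Real.rpow_add hx]
    norm_num
  simp only [hexp] at h1
  have e : ∑ k ∈ S, a k / (l k + 1) * (l k + 2 - 1) * (x ^ l k * x ^ 2) =
      (∑ k ∈ S, a k * x ^ l k) * x ^ 2 := by
    rw [Finset.sum_mul]
    refine Finset.sum_congr rfl fun k _ => ?_
    have := hlpos k
    have : l k + 1 ≠ 0 := by positivity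
    field_simp
    ring
  rw [e, abs_mul, abs_of_pos (by positivity : 0 < x ^ 2)] at h1
  have hN : 0 ≤ ∫ t in (0 : ℝ)..1, |∑ k ∈ S, a k * t ^ l k| :=
    intervalIntegral.integral_nonneg zero_le_one fun t _ => abs_nonneg _
  have h2 := Real.sqrt_le_sqrt (cauchyForm_le_sq_integral S a fun k => (hlpos k).le)
  rw [Real.sqrt_sq hN] at h2
  refine le_of_mul_le_mul_right (h1.trans ?_) (by positivity : 0 < x ^ 2)
  calc _ ≤ C * (x ^ (l₀ / 2) * x ^ 2) * ∫ t in (0 : ℝ)..1, |∑ k ∈ S, a k * t ^ l k| := by gcongr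
    _ = _ := by ring

/-- The constant term of a real Müntz polynomial is bounded by its `L¹` norm. -/
theorem exists_abs_constant_le {l : ℕ → ℝ} (h0 : l 0 = 0) (hl : ∀ k, 1 ≤ k → 0 < l k)
    (hs : Summable fun k => 1 / l k) :
    ∃ C : ℝ, 0 ≤ C ∧ ∀ (S : Finset ℕ) (a : ℕ → ℝ), 0 ∉ S →
      |a 0| ≤ C * ∫ t in (0 : ℝ)..1, |∑ k ∈ insert 0 S, a k * t ^ l k| := by
  have hl' : ∀ k, 0 ≤ l k := fun k => by
    rcases Nat.eq_zero_or_pos k with rfl | hk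
    · exact h0.ge
    · exact (hl k hk).le
  obtain ⟨C, hC, hprod⟩ := exists_prod_one_add_le (u := fun k => 4 * (1 / l k))
    (fun k => by have := hl' k; positivity) (hs.mul_left 4) one_pos
  refine ⟨2 * (C * Real.exp (1 * 1)), by positivity, fun S a hS => ?_⟩
  have h1 := sq_mul_prod_le_cauchyForm S (q := fun k => l k + 2)
    (fun k => by linarith [hl' k]) (fun k => a k / (l k + 1)) hS
  have h2 := h1.trans (cauchyForm_le_sq_integral (insert 0 S) a hl')
  have hN : 0 ≤ ∫ t in (0 : ℝ)..1, |∑ k ∈ insert 0 S, a k * t ^ l k| :=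
    intervalIntegral.integral_nonneg zero_le_one fun t _ => abs_nonneg _
  set N := ∫ t in (0 : ℝ)..1, |∑ k ∈ insert 0 S, a k * t ^ l k|
  have h3 := hprod S 1 zero_le_one
  set P := ∏ k ∈ S, (1 + 4 * (1 / l k) * 1)
  -- For q 0 = 2 the factors are −l k / (l k + 4), with inverse −(1 + 4 / l k), so summability keeps
  -- their product away from 0.
  have h4 : (∏ k ∈ S, ((l 0 + 2 - (l k + 2)) / (l 0 + 2 + (l k + 2))) ^ 2) * P ^ 2 = 1 := by
    rw [← Finset.prod_pow, ← Finset.prod_mul_distrib]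
    refine Finset.prod_eq_one fun k hk => ?_
    have hk0 : k ≠ 0 := by rintro rfl; exact hS hk
    have := hl k (Nat.one_le_iff_ne_zero.2 hk0)
    rw [h0]
    have h5 : (0 + 2 + (l k + 2)) ≠ 0 := by positivity
    field_simp
    ring
  have hP : 0 ≤ P := Finset.prod_nonneg fun k _ => by have := hl' k; positivity
  have h5 : |a 0| ≤ 2 * (P * N) := by
    refine abs_le_of_sq_le_sq ?_ (by positivity)
    have h6 : a 0 ^ 2 / 4 *
        ∏ k ∈ S, ((l 0 + 2 - (l k + 2)) / (l 0 + 2 + (l k + 2))) ^ 2 ≤ N ^ 2 := by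
      refine le_trans (le_of_eq ?_) h2
      rw [h0]
      norm_num
    have h7 := mul_le_mul_of_nonneg_right h6 (sq_nonneg P)
    rw [mul_assoc, h4] at h7
    nlinarith
  calc |a 0| ≤ 2 * (P * N) := h5
    _ ≤ 2 * (C * Real.exp (1 * 1) * N) := by gcongr
    _ = _ := by ring

end

section

/-! ### Pointwise bounds on the span of the monomials -/

/-- If l 0 > 0 the polynomial vanishes at 0 and the positive-exponent bound applies. If l 0 = 0 the
value at 0 is the constant term, which is estimated first and removed. -/
theorem exists_real_bound {l : ℕ → ℝ} (hl0 : 0 ≤ l 0) (hl : StrictMono l)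
    (hs : Summable fun k => 1 / l k) {r : ℝ} (hr : r < 1) :
    ∃ C ε : ℝ, 0 ≤ C ∧ 0 < ε ∧ ∀ (S : Finset ℕ) (a : ℕ → ℝ), 0 ∉ S → ∀ x : ℝ, 0 ≤ x → x ≤ r →
      |∑ k ∈ insert 0 S, a k * x ^ l k - ∑ k ∈ insert 0 S, a k * 0 ^ l k| ≤
          C * x ^ ε * ∫ t in (0 : ℝ)..1, |∑ k ∈ insert 0 S, a k * t ^ l k| ∧
      |∑ k ∈ insert 0 S, a k * 0 ^ l k| ≤
          C * ∫ t in (0 : ℝ)..1, |∑ k ∈ insert 0 S, a k * t ^ l k| := by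
  have hl1 : ∀ k, 1 ≤ k → l 1 ≤ l k := fun k hk => hl.monotone hk
  have h01 : l 0 < l 1 := hl one_pos
  have hnn : ∀ k, 0 ≤ l k := fun k => hl0.trans (hl.monotone (Nat.zero_le k))
  have hN : ∀ (S : Finset ℕ) (a : ℕ → ℝ),
      0 ≤ ∫ t in (0 : ℝ)..1, |∑ k ∈ insert 0 S, a k * t ^ l k| := fun S a =>
    intervalIntegral.integral_nonneg zero_le_one fun t _ => abs_nonneg _
  rcases hl0.eq_or_lt with h0 | h0
  -- Index 0 is given the dummy exponent l 1 so that all exponents are positive; it never occurs,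
  -- because 0 ∉ S.
  · set l' : ℕ → ℝ := fun k => if k = 0 then l 1 else l k with hl'def
    have hl' : ∀ k, k ≠ 0 → l' k = l k := fun k hk => by simp [hl'def, hk]
    obtain ⟨C₁, hC₁, h₁⟩ := exists_abs_sum_rpow_le (l := l') (l₀ := l 1) (r := r) (by linarith)
      (fun k => by
        rcases eq_or_ne k 0 with rfl | hk
        · simp [hl'def]
        · rw [hl' k hk]; exact hl1 k (Nat.one_le_iff_ne_zero.2 hk))
      (by
        rw [← summable_nat_add_iff 1] at hs ⊢
        exact hs.congr fun k => by rw [hl' _ (Nat.succ_ne_zero k)]) hr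
    obtain ⟨C₂, hC₂, h₂⟩ := exists_abs_constant_le h0.symm
      (fun k hk => by linarith [hl1 k hk]) hs
    refine ⟨C₁ * (1 + C₂) + C₂, l 1 / 2, by positivity, by linarith, fun S a hS x hx hxr => ?_⟩
    have hsum : ∀ t : ℝ, ∑ k ∈ insert 0 S, a k * t ^ l k = a 0 + ∑ k ∈ S, a k * t ^ l' k := by
      intro t
      rw [Finset.sum_insert hS, ← h0, Real.rpow_zero, mul_one]
      congr 1
      refine Finset.sum_congr rfl fun k hk => ?_
      rw [hl' k (by rintro rfl; exact hS hk)]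
    have hz : ∑ k ∈ insert 0 S, a k * (0 : ℝ) ^ l k = a 0 := by
      rw [hsum, Finset.sum_eq_zero, add_zero]
      intro k hk
      have hk0 : k ≠ 0 := by rintro rfl; exact hS hk
      rw [hl' k hk0, Real.zero_rpow, mul_zero]
      have := hl1 k (Nat.one_le_iff_ne_zero.2 hk0)
      linarith
    have ha := h₂ S a hS
    have hNS := hN S a
    set N := ∫ t in (0 : ℝ)..1, |∑ k ∈ insert 0 S, a k * t ^ l k| with hNdef
    have hint : ∫ t in (0 : ℝ)..1, |∑ k ∈ S, a k * t ^ l' k| ≤ N + |a 0| := by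
      have hc : Continuous fun t : ℝ => ∑ k ∈ insert 0 S, a k * t ^ l k :=
        continuous_sum_rpow _ a hnn
      have hc' : Continuous fun t : ℝ => ∑ k ∈ S, a k * t ^ l' k := by
        have := hc.sub (continuous_const (y := a 0))
        refine this.congr fun t => ?_
        simp only [Pi.sub_apply]
        rw [hsum]; ring
      calc ∫ t in (0 : ℝ)..1, |∑ k ∈ S, a k * t ^ l' k|
          ≤ ∫ t in (0 : ℝ)..1, (|∑ k ∈ insert 0 S, a k * t ^ l k| + |a 0|) := by
            refine intervalIntegral.integral_mono_on zero_le_one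
              (hc'.abs.intervalIntegrable _ _)
              ((hc.abs.add continuous_const).intervalIntegrable _ _) fun t _ => ?_
            have : ∑ k ∈ S, a k * t ^ l' k = (∑ k ∈ insert 0 S, a k * t ^ l k) - a 0 := by
              rw [hsum]; ring
            rw [this]
            exact abs_sub _ _
        _ = N + |a 0| := by
            rw [intervalIntegral.integral_add (hc.abs.intervalIntegrable _ _)
              (continuous_const.intervalIntegrable _ _)]
            simp [hNdef]
    rw [hz]
    refine ⟨?_, ha.trans (by gcongr; nlinarith [mul_nonneg hC₁ (add_nonneg zero_le_one hC₂)])⟩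
    rw [hsum, add_sub_cancel_left]
    have hxp : 0 ≤ x ^ (l 1 / 2) := Real.rpow_nonneg hx _
    calc _ ≤ C₁ * x ^ (l 1 / 2) * ∫ t in (0 : ℝ)..1, |∑ k ∈ S, a k * t ^ l' k| := h₁ S a x hx hxr
      _ ≤ C₁ * x ^ (l 1 / 2) * (N + C₂ * N) := by gcongr; linarith
      _ = (C₁ * (1 + C₂)) * x ^ (l 1 / 2) * N := by ring
      _ ≤ _ := by gcongr; linarith
  · obtain ⟨C, hC, h⟩ := exists_abs_sum_rpow_le h0 (fun k => hl.monotone (Nat.zero_le k)) hs hr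
    refine ⟨C, l 0 / 2, hC, by linarith, fun S a hS x hx hxr => ?_⟩
    have hz : ∑ k ∈ insert 0 S, a k * (0 : ℝ) ^ l k = 0 := by
      refine Finset.sum_eq_zero fun k _ => ?_
      have := hl.monotone (Nat.zero_le k)
      rw [Real.zero_rpow (by linarith), mul_zero]
    rw [hz, sub_zero]
    exact ⟨h _ a x hx hxr, by rw [abs_zero]; exact mul_nonneg hC (hN S a)⟩

/-! ### Integration over the unit interval and passage to scalars in 𝕜 -/

theorem integral_Iic_unitInterval {E : Type*} [NormedAddCommGroup E] [NormedSpace ℝ E]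
    (g : ℝ → E) (x : I) :
    ∫ t in Iic x, g (t : I) = ∫ t in (0 : ℝ)..x, g t := by
  rw [← integral_indicator measurableSet_Iic]
  have : ∀ t : I, (Iic x).indicator (fun t : I => g t) t = (Iic (x : ℝ)).indicator g t := by
    intro t
    by_cases h : t ≤ x
    · rw [indicator_of_mem (show t ∈ Iic x from h),
        indicator_of_mem (show (t : ℝ) ∈ Iic (x : ℝ) from h)]
    · rw [indicator_of_notMem (show t ∉ Iic x from h),
        indicator_of_notMem (show (t : ℝ) ∉ Iic (x : ℝ) from h)]
  simp_rw [this]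
  rw [show (volume : Measure I) = Measure.comap Subtype.val volume from rfl,
    integral_subtype_comap measurableSet_Icc (fun t => (Iic (x : ℝ)).indicator g t),
    setIntegral_indicator measurableSet_Iic, intervalIntegral.integral_of_le x.2.1,
    ← integral_Icc_eq_integral_Ioc]
  congr 2
  ext t
  simp only [mem_inter_iff, mem_Icc, mem_Iic]
  exact ⟨fun h => ⟨h.1.1, h.2⟩, fun h => ⟨⟨h.1, h.2.trans x.2.2⟩, h.2⟩⟩

theorem integral_unitInterval {E : Type*} [NormedAddCommGroup E] [NormedSpace ℝ E] (g : ℝ → E) :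
    ∫ t : I, g t = ∫ t in (0 : ℝ)..1, g t := by
  have := integral_Iic_unitInterval g 1
  rwa [show Iic (1 : I) = univ from eq_univ_of_forall fun t => unitInterval.le_one',
    Measure.restrict_univ] at this

variable {𝕜 : Type*} [RCLike 𝕜] {Λ : ℕ → ℝ≥0}

theorem norm_toLp_eq (f : C(I, 𝕜)) :
    ‖ContinuousMap.toLp (E := 𝕜) 1 (volume : Measure I) 𝕜 f‖ = ∫ t : I, ‖f t‖ := by
  rw [L1.norm_eq_integral_norm]
  refine integral_congr_ae ?_
  filter_upwards [ContinuousMap.coeFn_toLp (p := 1) (𝕜 := 𝕜) (volume : Measure I) f] with t ht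
  rw [ht]

theorem mem_muntzSpan_iff {f : C(I, 𝕜)} : f ∈ muntzSpan 𝕜 Λ ↔
    ∃ (S : Finset ℕ) (a : ℕ → 𝕜), 0 ∉ S ∧
      ∀ x : I, f x = ∑ k ∈ insert 0 S, a k * (((x : ℝ) ^ (Λ k : ℝ) : ℝ) : 𝕜) := by
  constructor
  · intro hf
    obtain ⟨c, rfl⟩ := Finsupp.mem_span_range_iff_exists_finsupp.1 hf
    refine ⟨c.support.erase 0, c, by simp, fun x => ?_⟩
    rw [Finsupp.sum, ContinuousMap.sum_apply]
    refine Finset.sum_subset_zero_on_sdiff (fun k hk => ?_) (fun k hk => ?_) fun k _ => ?_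
    · by_cases h : k = 0
      · simp [h]
      · simp [h, Finsupp.mem_support_iff.1 hk]
    · have : c k = 0 := by simpa using (Finset.mem_sdiff.1 hk).2
      simp [this]
    · rfl
  · rintro ⟨S, a, _, h⟩
    have : f = ∑ k ∈ insert 0 S, a k • monomial 𝕜 (Λ k) := by
      ext x
      rw [h, ContinuousMap.sum_apply]
      rfl
    rw [this]
    exact Submodule.sum_mem _ fun k _ => Submodule.smul_mem _ _ (Submodule.subset_span ⟨k, rfl⟩)

/-- Müntz polynomials are bounded away from `1` by their `L¹` norm, with a modulus of continuity
at `0`. -/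
theorem exists_muntzSpan_bound (hΛ : StrictMono Λ) (hM : MuntzCondition Λ) {r : ℝ} (hr : r < 1) :
    ∃ C ε : ℝ, 0 ≤ C ∧ 0 < ε ∧ ∀ f ∈ muntzSpan 𝕜 Λ, ∀ x : I, (x : ℝ) ≤ r →
      ‖f x - f 0‖ ≤ C * (x : ℝ) ^ ε * ‖ContinuousMap.toLp (E := 𝕜) 1 (volume : Measure I) 𝕜 f‖ ∧
      ‖f 0‖ ≤ C * ‖ContinuousMap.toLp (E := 𝕜) 1 (volume : Measure I) 𝕜 f‖ := by
  obtain ⟨C, ε, hC, hε, h⟩ := exists_real_bound (l := fun k => (Λ k : ℝ)) (Λ 0).2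
    (fun i j hij => hΛ hij) hM hr
  refine ⟨2 * C, ε, by positivity, hε, fun f hf x hx => ?_⟩
  obtain ⟨S, a, hS, hfa⟩ := mem_muntzSpan_iff.1 hf
  rw [norm_toLp_eq]
  set N := ∫ t : I, ‖f t‖
  -- Real and imaginary parts of a Müntz polynomial are real Müntz polynomials of no larger L¹ norm;
  -- adding the two estimates gives the factor 2.
  have hL : ∀ L : 𝕜 →L[ℝ] ℝ, (∀ z, |L z| ≤ ‖z‖) →
      |L (f x - f 0)| ≤ C * (x : ℝ) ^ ε * N ∧ |L (f 0)| ≤ C * N := by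
    intro L hL
    have hLs : ∀ t : I, L (f t) = ∑ k ∈ insert 0 S, L (a k) * (t : ℝ) ^ (Λ k : ℝ) := by
      intro t
      rw [hfa, map_sum]
      refine Finset.sum_congr rfl fun k _ => ?_
      rw [mul_comm, ← RCLike.real_smul_eq_coe_mul, map_smul, smul_eq_mul, mul_comm]
    have hN : ∫ t in (0 : ℝ)..1, |∑ k ∈ insert 0 S, L (a k) * t ^ (Λ k : ℝ)| ≤ N := by
      rw [← integral_unitInterval (fun t => |∑ k ∈ insert 0 S, L (a k) * t ^ (Λ k : ℝ)|)]
      simp_rw [← hLs]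
      refine integral_mono (μ := (volume : Measure I)) ?_ ?_ fun t => hL _
      · exact ((L.continuous.comp f.continuous).abs).integrable_of_hasCompactSupport
          (HasCompactSupport.of_compactSpace _)
      · exact (f.continuous.norm).integrable_of_hasCompactSupport
          (HasCompactSupport.of_compactSpace _)
    obtain ⟨h1, h2⟩ := h S (fun k => L (a k)) hS x x.2.1 hx
    have h0 := hLs 0
    rw [Icc.coe_zero] at h0
    have hxε : 0 ≤ (x : ℝ) ^ ε := Real.rpow_nonneg x.2.1 _
    rw [map_sub, hLs x, h0]
    exact ⟨h1.trans (by gcongr), h2.trans (by gcongr)⟩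
  have hre := hL RCLike.reCLM fun z => RCLike.abs_re_le_norm z
  have him := hL RCLike.imCLM fun z => RCLike.abs_im_le_norm z
  have hnorm : ∀ z : 𝕜, ‖z‖ ≤ |RCLike.reCLM z| + |RCLike.imCLM z| := by
    intro z
    refine abs_le_of_sq_le_sq' ?_ (by positivity) |>.2
    rw [RCLike.norm_sq_eq_def, add_sq, sq_abs, sq_abs, RCLike.reCLM_apply, RCLike.imCLM_apply]
    nlinarith [mul_nonneg (abs_nonneg (RCLike.re z)) (abs_nonneg (RCLike.im z))]
  constructor
  · refine (hnorm _).trans ((add_le_add hre.1 him.1).trans_eq ?_)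
    ring
  · refine (hnorm _).trans ((add_le_add hre.2 him.2).trans_eq ?_)
    ring

end

section

variable {𝕜 : Type*} [RCLike 𝕜] {Λ : ℕ → ℝ≥0}

/-! ### The Volterra operator -/

theorem volterra_sub (f : Lp 𝕜 1 (volume : Measure I)) {r x : I} (h : r ≤ x) :
    volterra f x - volterra f r = ∫ t in Ioc r x, f t := by
  have hf := L1.integrable_coeFn f
  rw [volterra, volterra, ← Iic_union_Ioc_eq_Iic h,
    setIntegral_union (Set.Iic_disjoint_Ioc le_rfl) measurableSet_Ioc hf.integrableOn
      hf.integrableOn, add_sub_cancel_left]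

/-- The source of the upper bound 1/2: the increments use the mass of f on disjoint intervals, so
half their difference has modulus at most ‖f‖ / 2. -/
theorem norm_volterra_sub_add_le (f : Lp 𝕜 1 (volume : Measure I)) {r x : I} (h : r ≤ x) :
    ‖volterra f x - volterra f r‖ + ‖volterra f 1 - volterra f x‖ ≤ ‖f‖ := by
  have hf := L1.integrable_coeFn f
  rw [volterra_sub f h, volterra_sub f unitInterval.le_one', L1.norm_eq_integral_norm]
  calc _ ≤ (∫ t in Ioc r x, ‖f t‖) + ∫ t in Ioc x 1, ‖f t‖ :=
        add_le_add (norm_integral_le_integral_norm _) (norm_integral_le_integral_norm _)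
    _ = ∫ t in Ioc r x ∪ Ioc x 1, ‖f t‖ :=
        (setIntegral_union (Set.Ioc_disjoint_Ioc_of_le le_rfl) measurableSet_Ioc
          hf.norm.integrableOn hf.norm.integrableOn).symm
    _ ≤ ∫ t, ‖f t‖ := setIntegral_le_integral hf.norm (Filter.Eventually.of_forall fun t => norm_nonneg _)

theorem continuous_volterra (f : Lp 𝕜 1 (volume : Measure I)) : Continuous (volterra f) := by
  have hf := L1.integrable_coeFn f
  rw [continuous_iff_continuousAt]
  intro x
  have e : volterra f = fun y => ∫ t, (Iic y).indicator (fun t => f t) t := by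
    ext y
    rw [integral_indicator measurableSet_Iic]
    rfl
  rw [e]
  refine continuousAt_of_dominated (bound := fun t => ‖f t‖)
    (Filter.Eventually.of_forall fun y => hf.aestronglyMeasurable.indicator measurableSet_Iic)
    (Filter.Eventually.of_forall fun y => Filter.Eventually.of_forall fun t =>
      norm_indicator_le_norm_self _ _) hf.norm ?_
  have hne : ∀ᵐ t : I ∂volume, t ≠ x := by
    simp [ae_iff, measure_singleton]
  filter_upwards [hne] with t ht
  rcases lt_or_gt_of_ne ht with h | h
  · refine (continuousAt_const (y := f t)).congr ?_
    filter_upwards [Ioi_mem_nhds h] with y hy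
    exact (indicator_of_mem (show t ∈ Iic y from (show t < y from hy).le) _).symm
  · refine (continuousAt_const (y := 0)).congr ?_
    filter_upwards [Iio_mem_nhds h] with y hy
    exact (indicator_of_notMem (show t ∉ Iic y from not_le.2 (show y < t from hy)) _).symm

/-- The Volterra operator from `L¹` to `C([0,1])`. -/
def volterraL (𝕜 : Type*) [RCLike 𝕜] : Lp 𝕜 1 (volume : Measure I) →L[𝕜] C(I, 𝕜) :=
  LinearMap.mkContinuous
    { toFun := fun f => ⟨volterra f, continuous_volterra f⟩
      map_add' := fun f g => by
        ext x
        simp only [ContinuousMap.coe_mk, ContinuousMap.add_apply, volterra]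
        rw [← integral_add (L1.integrable_coeFn f).integrableOn
          (L1.integrable_coeFn g).integrableOn]
        exact integral_congr_ae (ae_restrict_of_ae (Lp.coeFn_add f g))
      map_smul' := fun c f => by
        ext x
        simp only [ContinuousMap.coe_mk, ContinuousMap.smul_apply, volterra, RingHom.id_apply]
        rw [← integral_smul]
        exact integral_congr_ae (ae_restrict_of_ae (Lp.coeFn_smul c f)) }
    1 (fun f => by
      rw [one_mul, ContinuousMap.norm_le _ (norm_nonneg _)]
      intro x
      refine (norm_integral_le_integral_norm _).trans ?_
      rw [L1.norm_eq_integral_norm]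
      exact setIntegral_le_integral (L1.integrable_coeFn f).norm
        (Filter.Eventually.of_forall fun t => norm_nonneg _))

theorem volterraL_apply (f : Lp 𝕜 1 (volume : Measure I)) (x : I) :
    volterraL 𝕜 f x = volterra f x := rfl

theorem norm_volterraL_apply_le (f : Lp 𝕜 1 (volume : Measure I)) (x : I) :
    ‖volterraL 𝕜 f x‖ ≤ ‖f‖ := by
  refine (norm_integral_le_integral_norm _).trans ?_
  rw [L1.norm_eq_integral_norm]
  exact setIntegral_le_integral (L1.integrable_coeFn f).norm
    (Filter.Eventually.of_forall fun t => norm_nonneg _)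

theorem volterraL_toLp (p : C(I, 𝕜)) (x : I) :
    volterraL 𝕜 (ContinuousMap.toLp (E := 𝕜) 1 (volume : Measure I) 𝕜 p) x =
      ∫ t in Iic x, p t :=
  integral_congr_ae (ae_restrict_of_ae (ContinuousMap.coeFn_toLp (volume : Measure I) p))

/-! ### The Cesàro operator on continuous functions -/

/-- The Cesàro operator on `C([0,1])`, as the average of the dilations of `p`. -/
def cesaroC (𝕜 : Type*) [RCLike 𝕜] : C(I, 𝕜) →ₗ[𝕜] C(I, 𝕜) where
  toFun p := ⟨fun x => ∫ t : I, p (t * x), by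
    refine continuous_of_dominated (bound := fun _ => ‖p‖)
      (fun x => Continuous.aestronglyMeasurable (by fun_prop))
      (fun x => Filter.Eventually.of_forall fun t => p.norm_coe_le_norm _)
      (integrable_const _) (Filter.Eventually.of_forall fun t => by fun_prop)⟩
  map_add' p r := by
    ext x
    have h : ∀ p : C(I, 𝕜), Integrable (fun t : I => p (t * x)) volume := fun p =>
      Continuous.integrable_of_hasCompactSupport (by fun_prop) (HasCompactSupport.of_compactSpace _)
    simpa using integral_add (h p) (h r)
  map_smul' c p := by
    ext x
    simpa using integral_const_mul c (fun t : I => p (t * x))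

theorem cesaroC_apply (p : C(I, 𝕜)) (x : I) : cesaroC 𝕜 p x = ∫ t : I, p (t * x) := rfl

theorem cesaroC_zero (p : C(I, 𝕜)) : cesaroC 𝕜 p 0 = p 0 := by
  simp [cesaroC_apply]

theorem norm_cesaroC_sub_le {p : C(I, 𝕜)} {x : I} {c : 𝕜} {B : ℝ} (h : ∀ t ≤ x, ‖p t - c‖ ≤ B) :
    ‖cesaroC 𝕜 p x - c‖ ≤ B := by
  have hi : Integrable (fun t : I => p (t * x)) volume :=
    Continuous.integrable_of_hasCompactSupport (by fun_prop) (HasCompactSupport.of_compactSpace _)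
  have : cesaroC 𝕜 p x - c = ∫ t : I, (p (t * x) - c) := by
    rw [integral_sub hi (integrable_const _)]
    simp [cesaroC_apply]
  rw [this]
  refine (norm_integral_le_of_norm_le_const (C := B)
    (Filter.Eventually.of_forall fun t => h _ unitInterval.mul_le_right)).trans ?_
  simp

theorem integral_rpow_Iic (a : ℝ≥0) (x : I) :
    ∫ t in Iic x, monomial 𝕜 a t = ((((x : ℝ) ^ ((a : ℝ) + 1) / (a + 1) : ℝ)) : 𝕜) := by
  have h := integral_Iic_unitInterval (fun t : ℝ => (((t ^ (a : ℝ) : ℝ)) : 𝕜)) x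
  have ha := a.coe_nonneg
  change ∫ t in Iic x, ((((t : ℝ) ^ (a : ℝ) : ℝ)) : 𝕜) = _
  rw [h, intervalIntegral.integral_of_le x.2.1, integral_ofReal,
    ← intervalIntegral.integral_of_le x.2.1, integral_rpow (Or.inl (by linarith)),
    Real.zero_rpow (by linarith), sub_zero]

theorem cesaroC_monomial (a : ℝ≥0) :
    cesaroC 𝕜 (monomial 𝕜 a) = (((1 / ((a : ℝ) + 1) : ℝ)) : 𝕜) • monomial 𝕜 a := by
  ext x
  have h := integral_rpow_Iic (𝕜 := 𝕜) a 1
  rw [show Iic (1 : I) = univ from eq_univ_of_forall fun t => unitInterval.le_one',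
    Measure.restrict_univ] at h
  have e : ∀ t : I, monomial 𝕜 a (t * x) = monomial 𝕜 a t * monomial 𝕜 a x := by
    intro t
    simp only [monomial, ContinuousMap.coe_mk, Icc.coe_mul]
    rw [Real.mul_rpow t.2.1 x.2.1, RCLike.ofReal_mul]
  rw [cesaroC_apply]
  simp_rw [e]
  rw [integral_mul_const, h]
  simp

theorem cesaroC_mem {p : C(I, 𝕜)} (hp : p ∈ muntzSpan 𝕜 Λ) : cesaroC 𝕜 p ∈ muntzSpan 𝕜 Λ := by
  induction hp using Submodule.span_induction with
  | mem p hp =>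
    obtain ⟨k, rfl⟩ := hp
    simp only [cesaroC_monomial]
    exact Submodule.smul_mem _ _ (Submodule.subset_span ⟨k, rfl⟩)
  | zero => simp
  | add p r _ _ h1 h2 => rw [map_add]; exact Submodule.add_mem _ h1 h2
  | smul c p _ h => rw [map_smul]; exact Submodule.smul_mem _ _ h

theorem mul_cesaroC {p : C(I, 𝕜)} (hp : p ∈ muntzSpan 𝕜 Λ) (x : I) :
    ((x : ℝ) : 𝕜) * cesaroC 𝕜 p x = ∫ t in Iic x, p t := by
  simp_rw [← volterraL_toLp]
  induction hp using Submodule.span_induction with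
  | mem p hp =>
    obtain ⟨k, rfl⟩ := hp
    simp only [volterraL_toLp, integral_rpow_Iic, cesaroC_monomial, ContinuousMap.smul_apply,
      smul_eq_mul]
    have : (0 : ℝ) ≤ Λ k := (Λ k).2
    simp only [monomial, ContinuousMap.coe_mk]
    rw [Real.rpow_add_one' x.2.1 (by linarith)]
    push_cast
    ring
  | zero => simp
  | add p r _ _ h1 h2 => simp only [map_add, ContinuousMap.add_apply, mul_add, h1, h2]
  | smul c p _ h =>
    simp only [map_smul, ContinuousMap.smul_apply, smul_eq_mul, ← h]
    ring

theorem norm_setIntegral_Iic_sub_le {p : C(I, 𝕜)} {x y : I} {B : ℝ} (hxy : x ≤ y)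
    (h : ∀ t ≤ y, ‖p t‖ ≤ B) :
    ‖(∫ t in Iic y, p t) - ∫ t in Iic x, p t‖ ≤ B * (y - x) := by
  rw [← volterraL_toLp, ← volterraL_toLp, volterraL_apply, volterraL_apply, volterra_sub _ hxy,
    integral_congr_ae (ae_restrict_of_ae (ContinuousMap.coeFn_toLp (volume : Measure I) p))]
  refine (norm_setIntegral_le_of_norm_le_const (C := B) (measure_lt_top _ _)
    fun t ht => h t ht.2).trans_eq ?_
  congr 1
  rw [Measure.real, unitInterval.volume_Ioc, ENNReal.toReal_ofReal (sub_nonneg.2 hxy)]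

/-- The map from Müntz polynomials to `M_Λ^1`. -/
def spanToL1 (𝕜 : Type*) [RCLike 𝕜] (Λ : ℕ → ℝ≥0) : muntzSpan 𝕜 Λ →ₗ[𝕜] muntzL1 𝕜 Λ :=
  ((ContinuousMap.toLp (E := 𝕜) 1 (volume : Measure I) 𝕜).toLinearMap.comp
    (muntzSpan 𝕜 Λ).subtype).codRestrict _ fun p =>
      Submodule.le_topologicalClosure _ (Submodule.mem_map_of_mem p.2)

theorem coe_spanToL1 (p : muntzSpan 𝕜 Λ) : (spanToL1 𝕜 Λ p : Lp 𝕜 1 (volume : Measure I)) =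
    ContinuousMap.toLp (E := 𝕜) 1 (volume : Measure I) 𝕜 p := rfl

theorem norm_spanToL1 (p : muntzSpan 𝕜 Λ) :
    ‖spanToL1 𝕜 Λ p‖ = ‖ContinuousMap.toLp (E := 𝕜) 1 (volume : Measure I) 𝕜 (p : C(I, 𝕜))‖ := rfl

theorem denseRange_spanToL1 : DenseRange (spanToL1 𝕜 Λ) := by
  refine Subtype.dense_iff.2 fun f hf => ?_
  refine closure_mono ?_ hf
  rintro _ ⟨p, hp, rfl⟩
  exact ⟨_, ⟨⟨p, hp⟩, rfl⟩, rfl⟩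

theorem exists_norm_le_spanToL1 (hΛ : StrictMono Λ) (hM : MuntzCondition Λ) {r : ℝ} (hr : r < 1) :
    ∃ C : ℝ, 0 ≤ C ∧ ∀ (p : muntzSpan 𝕜 Λ) (x : I), (x : ℝ) ≤ r →
      ‖(p : C(I, 𝕜)) x‖ ≤ C * ‖spanToL1 𝕜 Λ p‖ := by
  obtain ⟨C, ε, hC, hε, h⟩ := exists_muntzSpan_bound (𝕜 := 𝕜) hΛ hM hr
  refine ⟨2 * C, by positivity, fun p x hx => ?_⟩
  obtain ⟨h1, h2⟩ := h p p.2 x hx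
  have h3 : (x : ℝ) ^ ε ≤ 1 := Real.rpow_le_one x.2.1 x.2.2 hε.le
  rw [norm_spanToL1]
  calc ‖(p : C(I, 𝕜)) x‖ = ‖((p : C(I, 𝕜)) x - (p : C(I, 𝕜)) 0) + (p : C(I, 𝕜)) 0‖ := by simp
    _ ≤ _ := norm_add_le _ _
    _ ≤ _ := add_le_add h1 h2
    _ ≤ C * 1 * _ + C * _ := by gcongr
    _ = _ := by ring

end

section

variable {𝕜 : Type*} [RCLike 𝕜] {Λ : ℕ → ℝ≥0}

/-! ### The Cesàro operator on `M_Λ^1` -/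

theorem isClosed_muntzC : IsClosed (muntzC 𝕜 Λ : Set C(I, 𝕜)) :=
  Submodule.isClosed_topologicalClosure _

/-- On [0, 1/2] an average is bounded by the pointwise bound of p; on the rest 1/x ≤ 2, so the L¹
norm suffices. -/
theorem exists_norm_cesaroC_le (hΛ : StrictMono Λ) (hM : MuntzCondition Λ) :
    ∃ C : ℝ, ∀ p : muntzSpan 𝕜 Λ, ‖cesaroC 𝕜 (p : C(I, 𝕜))‖ ≤ C * ‖spanToL1 𝕜 Λ p‖ := by
  obtain ⟨C, hC, h⟩ := exists_norm_le_spanToL1 (𝕜 := 𝕜) hΛ hM (r := 1 / 2) (by norm_num)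
  refine ⟨C + 2, fun p => ?_⟩
  rw [ContinuousMap.norm_le _ (by positivity)]
  intro x
  have hN := norm_nonneg (spanToL1 𝕜 Λ p)
  rcases le_or_gt (x : ℝ) (1 / 2) with hx | hx
  · have := norm_cesaroC_sub_le (p := (p : C(I, 𝕜))) (x := x) (c := 0)
      (B := C * ‖spanToL1 𝕜 Λ p‖) fun t ht => by
        rw [sub_zero]; exact h p t (le_trans ht hx)
    rw [sub_zero] at this
    nlinarith
  · have h1 := mul_cesaroC p.2 x
    rw [← volterraL_toLp] at h1
    have h2 := norm_volterraL_apply_le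
      (ContinuousMap.toLp (E := 𝕜) 1 (volume : Measure I) 𝕜 (p : C(I, 𝕜))) x
    rw [← h1, norm_mul, RCLike.norm_ofReal, abs_of_nonneg x.2.1, ← norm_spanToL1] at h2
    nlinarith [norm_nonneg (cesaroC 𝕜 (p : C(I, 𝕜)) x), mul_nonneg hC hN]

/-- The map `ι` need not be injective: the estimate makes g vanish where `ι` does, so g factors
through the image of P and extends by density. -/
theorem exists_extension {X Y B : Type*} [NormedAddCommGroup X] [NormedSpace 𝕜 X] [NormedAddCommGroup Y]
   [NormedSpace 𝕜 Y] [CompleteSpace Y] [AddCommGroup B] [Module 𝕜 B] (P : Submodule 𝕜 B) (ι : B →ₗ[𝕜] X)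
   (g : B →ₗ[𝕜] Y)
   (h : ∃ C : ℝ, ∀ p ∈ P, ‖g p‖ ≤ C * ‖ι p‖) : ∃ T : (P.map ι).topologicalClosure →L[𝕜] Y,
    ∀ (p : B) (hp : p ∈ P), T ⟨ι p, Submodule.le_topologicalClosure _ (Submodule.mem_map_of_mem hp)⟩ = g p := by
  set e : P →ₗ[𝕜] (P.map ι).topologicalClosure := (ι.comp P.subtype).codRestrict _ fun p =>
      Submodule.le_topologicalClosure _ (Submodule.mem_map_of_mem p.2)
  have he : DenseRange e := by
    refine Subtype.dense_iff.2 fun f hf => ?_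
    refine closure_mono ?_ hf
    rintro _ ⟨p, hp, rfl⟩
    exact ⟨_, ⟨⟨p, hp⟩, rfl⟩, rfl⟩
  obtain ⟨C, hC⟩ := h
  exact ⟨(g.comp P.subtype).extendOfNorm e, fun p hp => LinearMap.extendOfNorm_eq (f := g.comp P.subtype) (e := e) he
    ⟨C, fun p => hC p p.2⟩ ⟨p, hp⟩⟩

/-- The Cesàro operator on Müntz polynomials extends to `M_Λ^1`. -/
theorem exists_cesaroL (hΛ : StrictMono Λ) (hM : MuntzCondition Λ) :
    ∃ Γ : muntzL1 𝕜 Λ →L[𝕜] C(I, 𝕜),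
      ∀ p : muntzSpan 𝕜 Λ, Γ (spanToL1 𝕜 Λ p) = cesaroC 𝕜 (p : C(I, 𝕜)) := by
  obtain ⟨C, hC⟩ := exists_norm_cesaroC_le (𝕜 := 𝕜) hΛ hM
  obtain ⟨T, hT⟩ := exists_extension (muntzSpan 𝕜 Λ)
    (ContinuousMap.toLp (E := 𝕜) 1 (volume : Measure I) 𝕜).toLinearMap (cesaroC 𝕜)
    ⟨C, fun p hp => hC ⟨p, hp⟩⟩
  exact ⟨T, fun p => hT p p.2⟩

theorem cesaroL_mem {Γ : muntzL1 𝕜 Λ →L[𝕜] C(I, 𝕜)}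
    (hΓ : ∀ p, Γ (spanToL1 𝕜 Λ p) = cesaroC 𝕜 (p : C(I, 𝕜))) (f : muntzL1 𝕜 Λ) :
    Γ f ∈ muntzC 𝕜 Λ := by
  refine denseRange_spanToL1.induction_on (p := fun f => Γ f ∈ muntzC 𝕜 Λ) f
    (isClosed_muntzC.preimage Γ.continuous) fun p => ?_
  rw [hΓ]
  exact Submodule.le_topologicalClosure _ (cesaroC_mem p.2)

theorem continuous_clm_apply (Γ : muntzL1 𝕜 Λ →L[𝕜] C(I, 𝕜)) (x : I) : Continuous fun f => Γ f x :=
  (continuous_eval_const x).comp Γ.continuous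

theorem mul_cesaroL {Γ : muntzL1 𝕜 Λ →L[𝕜] C(I, 𝕜)}
    (hΓ : ∀ p, Γ (spanToL1 𝕜 Λ p) = cesaroC 𝕜 (p : C(I, 𝕜))) (f : muntzL1 𝕜 Λ) (x : I) :
    ((x : ℝ) : 𝕜) * Γ f x = volterra (f : Lp 𝕜 1 (volume : Measure I)) x := by
  have hV : Continuous fun f : muntzL1 𝕜 Λ =>
      volterraL 𝕜 (f : Lp 𝕜 1 (volume : Measure I)) x :=
    (continuous_eval_const x).comp
      ((volterraL 𝕜).continuous.comp continuous_subtype_val)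
  refine denseRange_spanToL1.induction_on
    (p := fun f : muntzL1 𝕜 Λ => ((x : ℝ) : 𝕜) * Γ f x =
      volterraL 𝕜 (f : Lp 𝕜 1 (volume : Measure I)) x) f
    (isClosed_eq (continuous_const.mul (continuous_clm_apply Γ x)) hV) fun p => ?_
  rw [hΓ, mul_cesaroC p.2, coe_spanToL1, volterraL_toLp]

/-- With u and v the values at x and y, x(u − v) = (xu − yv) − (x − y)v, and xu − yv is an integral
of f between x and y. The factor x makes this useless at 0. -/
theorem exists_mul_norm_cesaroL_sub_le (hΛ : StrictMono Λ) (hM : MuntzCondition Λ)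
    {Γ : muntzL1 𝕜 Λ →L[𝕜] C(I, 𝕜)}
    (hΓ : ∀ p, Γ (spanToL1 𝕜 Λ p) = cesaroC 𝕜 (p : C(I, 𝕜))) {r : ℝ}
    (hr : r < 1) :
    ∃ C : ℝ, 0 ≤ C ∧ ∀ (f : muntzL1 𝕜 Λ) (x y : I), (x : ℝ) ≤ r → (y : ℝ) ≤ r →
      (x : ℝ) * ‖Γ f x - Γ f y‖ ≤
        C * |(x : ℝ) - y| * ‖f‖ := by
  obtain ⟨C, hC, h⟩ := exists_norm_le_spanToL1 (𝕜 := 𝕜) hΛ hM hr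
  refine ⟨2 * C, by positivity, fun f x y hx hy => ?_⟩
  refine denseRange_spanToL1.induction_on
    (p := fun f : muntzL1 𝕜 Λ =>
      (x : ℝ) * ‖Γ f x - Γ f y‖ ≤
        2 * C * |(x : ℝ) - y| * ‖f‖) f
    (isClosed_le (continuous_const.mul
      ((continuous_clm_apply Γ x).sub (continuous_clm_apply Γ y)).norm)
      (continuous_const.mul continuous_norm)) fun p => ?_
  rw [hΓ]
  set N := ‖spanToL1 𝕜 Λ p‖
  have h1 : ‖cesaroC 𝕜 (p : C(I, 𝕜)) y‖ ≤ C * N := by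
    have := norm_cesaroC_sub_le (p := (p : C(I, 𝕜))) (x := y) (c := 0) (B := C * N)
      fun t ht => by rw [sub_zero]; exact h p t (le_trans ht hy)
    rwa [sub_zero] at this
  have h2 : ‖(∫ t in Iic x, (p : C(I, 𝕜)) t) - ∫ t in Iic y, (p : C(I, 𝕜)) t‖ ≤
      C * N * |(x : ℝ) - y| := by
    rcases le_total x y with hxy | hxy
    · rw [norm_sub_rev, abs_sub_comm, abs_of_nonneg (sub_nonneg.2 (show (x : ℝ) ≤ y from hxy))]
      exact norm_setIntegral_Iic_sub_le hxy fun t ht => h p t (le_trans ht hy)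
    · rw [abs_of_nonneg (sub_nonneg.2 (show (y : ℝ) ≤ x from hxy))]
      exact norm_setIntegral_Iic_sub_le hxy fun t ht => h p t (le_trans ht hx)
  rw [← mul_cesaroC p.2, ← mul_cesaroC p.2] at h2
  set u := cesaroC 𝕜 (p : C(I, 𝕜)) x
  set v := cesaroC 𝕜 (p : C(I, 𝕜)) y
  calc (x : ℝ) * ‖u - v‖ = ‖((x : ℝ) : 𝕜) * (u - v)‖ := by
        rw [norm_mul, RCLike.norm_ofReal, abs_of_nonneg x.2.1]
    _ = ‖(((x : ℝ) : 𝕜) * u - ((y : ℝ) : 𝕜) * v) - (((x : ℝ) - y : ℝ) : 𝕜) * v‖ := by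
        congr 1
        push_cast
        ring
    _ ≤ C * N * |(x : ℝ) - y| + |(x : ℝ) - y| * (C * N) := by
        refine (norm_sub_le _ _).trans (add_le_add h2 ?_)
        rw [norm_mul, RCLike.norm_ofReal]
        gcongr
    _ = _ := by ring

/-- Equicontinuity at 0: averages over [0, x] inherit the modulus x ^ ε of p. -/
theorem exists_norm_cesaroL_sub_zero_le (hΛ : StrictMono Λ) (hM : MuntzCondition Λ)
    {Γ : muntzL1 𝕜 Λ →L[𝕜] C(I, 𝕜)}
    (hΓ : ∀ p, Γ (spanToL1 𝕜 Λ p) = cesaroC 𝕜 (p : C(I, 𝕜))) {r : ℝ}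
    (hr : r < 1) :
    ∃ C ε : ℝ, 0 ≤ C ∧ 0 < ε ∧ ∀ (f : muntzL1 𝕜 Λ) (x : I), (x : ℝ) ≤ r →
      ‖Γ f x - Γ f 0‖ ≤ C * (x : ℝ) ^ ε * ‖f‖ := by
  obtain ⟨C, ε, hC, hε, h⟩ := exists_muntzSpan_bound (𝕜 := 𝕜) hΛ hM hr
  refine ⟨C, ε, hC, hε, fun f x hx => ?_⟩
  refine denseRange_spanToL1.induction_on
    (p := fun f : muntzL1 𝕜 Λ =>
      ‖Γ f x - Γ f 0‖ ≤ C * (x : ℝ) ^ ε * ‖f‖) f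
    (isClosed_le ((continuous_clm_apply Γ x).sub (continuous_clm_apply Γ 0)).norm
      (continuous_const.mul continuous_norm)) fun p => ?_
  rw [hΓ, cesaroC_zero]
  refine norm_cesaroC_sub_le fun t ht => (h p p.2 t (le_trans ht hx)).1.trans ?_
  have : (t : ℝ) ^ ε ≤ (x : ℝ) ^ ε := Real.rpow_le_rpow t.2.1 ht hε.le
  rw [norm_spanToL1]
  gcongr

/-- The images of the unit ball under the Cesàro operator are equicontinuous away from `1`. -/
theorem equicontinuousAt_cesaroL (hΛ : StrictMono Λ) (hM : MuntzCondition Λ)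
    {Γ : muntzL1 𝕜 Λ →L[𝕜] C(I, 𝕜)}
    (hΓ : ∀ p, Γ (spanToL1 𝕜 Λ p) = cesaroC 𝕜 (p : C(I, 𝕜))) {x : I} (hx : x < 1) :
    EquicontinuousAt (fun (f : Metric.closedBall (0 : muntzL1 𝕜 Λ) 1) (x : I) =>
      Γ f x) x := by
  have hx1 : (x : ℝ) < 1 := hx
  rw [Metric.equicontinuousAt_iff]
  intro ε hε
  set r := ((x : ℝ) + 1) / 2 with hrdef
  have hr : r < 1 := by rw [hrdef]; linarith
  rcases eq_or_ne x 0 with rfl | hx0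
  · obtain ⟨C, e, hC, he, h⟩ := exists_norm_cesaroL_sub_zero_le hΛ hM hΓ hr
    have ht : Filter.Tendsto (fun s : ℝ => C * s ^ e) (nhds 0) (nhds 0) := by
      have : Continuous fun s : ℝ => C * s ^ e :=
        continuous_const.mul (Real.continuous_rpow_const he.le)
      simpa [Real.zero_rpow he.ne'] using this.tendsto 0
    obtain ⟨δ, hδ, hδ'⟩ := Metric.eventually_nhds_iff.1 (ht.eventually_lt_const hε)
    refine ⟨min δ (1 / 2), by positivity, fun y hy f => ?_⟩
    have hy' : |(y : ℝ)| < min δ (1 / 2) := by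
      have : dist y 0 = |(y : ℝ) - ((0 : I) : ℝ)| := rfl
      rw [this] at hy
      simpa using hy
    have hf : ‖(f : muntzL1 𝕜 Λ)‖ ≤ 1 :=
      mem_closedBall_zero_iff.1 f.2
    rw [dist_eq_norm, norm_sub_rev]
    refine (h f y ?_).trans_lt ?_
    · rw [hrdef]
      have := (le_abs_self _).trans (hy'.le.trans (min_le_right _ _))
      simpa using this
    · have h1 := hδ' (y := (y : ℝ)) (by simpa using hy'.trans_le (min_le_left _ _))
      refine lt_of_le_of_lt ?_ h1
      have : 0 ≤ C * (y : ℝ) ^ e := mul_nonneg hC (Real.rpow_nonneg y.2.1 _)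
      nlinarith
  · obtain ⟨C, hC, h⟩ := exists_mul_norm_cesaroL_sub_le hΛ hM hΓ hr
    have hxpos : 0 < (x : ℝ) := lt_of_le_of_ne x.2.1 fun h => hx0 (Subtype.ext h.symm)
    refine ⟨min (x * ε / (C + 1)) ((1 - x) / 2), lt_min (by positivity) (by linarith),
      fun y hy f => ?_⟩
    have hy' : |(y : ℝ) - x| < min (x * ε / (C + 1)) ((1 - x) / 2) := hy
    have hf : ‖(f : muntzL1 𝕜 Λ)‖ ≤ 1 :=
      mem_closedBall_zero_iff.1 f.2
    have hyr : (y : ℝ) ≤ r := by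
      have := (le_abs_self _).trans (hy'.le.trans (min_le_right _ _))
      rw [hrdef]
      linarith
    have h1 := h f x y (by rw [hrdef]; linarith) hyr
    rw [dist_eq_norm]
    refine lt_of_mul_lt_mul_left (lt_of_le_of_lt h1 ?_) hxpos.le
    have h2 := hy'.trans_le (min_le_left _ _)
    rw [lt_div_iff₀ (by positivity), abs_sub_comm] at h2
    have h3 : 0 ≤ C * |(x : ℝ) - y| := by positivity
    rcases eq_or_lt_of_le (abs_nonneg ((x : ℝ) - y)) with h4 | h4
    · rw [← h4]; simp; positivity
    · nlinarith

theorem isCesaroTransform_cesaroL (hΛ : StrictMono Λ) (hM : MuntzCondition Λ)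
    {Γ : muntzL1 𝕜 Λ →L[𝕜] C(I, 𝕜)}
    (hΓ : ∀ p, Γ (spanToL1 𝕜 Λ p) = cesaroC 𝕜 (p : C(I, 𝕜)))
    (f : muntzL1 𝕜 Λ) :
    IsCesaroTransform (f : Lp 𝕜 1 (volume : Measure I)) (Γ f) := by
  constructor
  · intro x hx
    have hx0 : ((x : ℝ) : 𝕜) ≠ 0 := by
      rw [RCLike.ofReal_ne_zero]
      exact fun h => hx (Subtype.ext h)
    rw [← mul_cesaroL hΓ, RCLike.ofReal_inv, inv_mul_cancel_left₀ hx0]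
  -- The continuous representative is the limit of approximating Müntz polynomials, which are
  -- uniformly Cauchy on each [0, r] with r < 1.
  obtain ⟨u, hu, hlim⟩ := mem_closure_iff_seq_limit.1 (denseRange_spanToL1 (𝕜 := 𝕜) (Λ := Λ) f)
  choose p hp using hu
  have hcauchy : CauchySeq u := hlim.cauchySeq
  have hbound : ∀ r : ℝ, r < 1 → UniformCauchySeqOn (fun n (x : I) => (p n : C(I, 𝕜)) x)
      Filter.atTop {x : I | (x : ℝ) ≤ r} := by
    intro r hr
    obtain ⟨C, hC, h⟩ := exists_norm_le_spanToL1 (𝕜 := 𝕜) hΛ hM hr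
    rw [Metric.uniformCauchySeqOn_iff]
    intro ε hε
    obtain ⟨N, hN⟩ := Metric.cauchySeq_iff.1 hcauchy (ε / (C + 1)) (by positivity)
    refine ⟨N, fun m hm n hn x hx => ?_⟩
    have h1 := h (p m - p n) x hx
    rw [map_sub (spanToL1 𝕜 Λ), hp, hp, ← dist_eq_norm (u m)] at h1
    rw [dist_eq_norm]
    refine lt_of_le_of_lt h1 ?_
    have h2 := hN m hm n hn
    rw [lt_div_iff₀ (by positivity)] at h2
    nlinarith [dist_nonneg (x := u m) (y := u n)]
  have hlimx : ∀ x : I, x < 1 → ∃ l, Filter.Tendsto (fun n => (p n : C(I, 𝕜)) x) Filter.atTop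
      (nhds l) := fun x hx =>
    cauchySeq_tendsto_of_complete ((hbound x hx).cauchySeq (show (x : ℝ) ≤ x from le_rfl))
  choose! f₀ hf₀ using hlimx
  refine ⟨f₀, ?_, ?_, ?_⟩
  · have : TendstoLocallyUniformlyOn (fun n (x : I) => (p n : C(I, 𝕜)) x) f₀ Filter.atTop
        (Iio 1) := by
      rw [tendstoLocallyUniformlyOn_iff_forall_isCompact isOpen_Iio]
      intro K hK hKc
      rcases K.eq_empty_or_nonempty with rfl | hne
      · exact tendstoUniformlyOn_empty
      obtain ⟨m, hm, hmax⟩ := hKc.exists_isMaxOn hne continuous_id.continuousOn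
      exact ((hbound m (hK hm)).mono fun x hx => hmax hx).tendstoUniformlyOn_of_tendsto
        fun x hx => hf₀ x (hK hx)
    exact this.continuousOn (Filter.Frequently.of_forall fun n => (p n : C(I, 𝕜)).continuous.continuousOn)
  · have hlim' : Filter.Tendsto (fun n => ContinuousMap.toLp (E := 𝕜) 1 (volume : Measure I) 𝕜
        (p n : C(I, 𝕜))) Filter.atTop (nhds (f : Lp 𝕜 1 (volume : Measure I))) := by
      have := (continuous_subtype_val.tendsto f).comp hlim
      refine this.congr fun n => ?_
      rw [Function.comp_apply, ← hp, coe_spanToL1]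
    -- L¹ convergence gives a subsequence converging almost everywhere, identifying the pointwise
    -- limit with f.
    have hmeas := tendstoInMeasure_of_tendsto_Lp hlim'
    obtain ⟨ns, hns, hae⟩ := hmeas.exists_seq_tendsto_ae
    have hne : ∀ᵐ t : I ∂volume, t ≠ 1 := by
      simp [ae_iff, measure_singleton]
    have hcoe : ∀ᵐ t : I ∂volume, ∀ n,
        ContinuousMap.toLp (E := 𝕜) 1 (volume : Measure I) 𝕜 (p n : C(I, 𝕜)) t =
          (p n : C(I, 𝕜)) t :=
      ae_all_iff.2 fun n => ContinuousMap.coeFn_toLp (volume : Measure I) _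
    filter_upwards [hae, hne, hcoe] with t h1 h2 h3
    have h4 := (hf₀ t (lt_of_le_of_ne unitInterval.le_one' h2)).comp hns.tendsto_atTop
    refine tendsto_nhds_unique h4 (h1.congr fun n => ?_)
    exact h3 _
  · have h1 := ((continuous_clm_apply Γ 0).tendsto f).comp hlim
    refine tendsto_nhds_unique h1 ((hf₀ 0 zero_lt_one).congr fun n => ?_)
    rw [Function.comp_apply, ← hp, hΓ, cesaroC_zero]

end

section

variable {𝕜 : Type*} [RCLike 𝕜] {X : Type*} [NormedAddCommGroup X] [NormedSpace 𝕜 X]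

/-! ### Approximation by compact operators -/

/-- The dilation `p ↦ p (r * ·)` of `C([0,1])`. -/
def dilation (𝕜 : Type*) [RCLike 𝕜] (r : I) : C(I, 𝕜) →L[𝕜] C(I, 𝕜) :=
  LinearMap.mkContinuous
    { toFun := fun p => p.comp ⟨fun x => r * x, by fun_prop⟩
      map_add' := fun _ _ => rfl
      map_smul' := fun _ _ => rfl } 1 (fun p => by
    rw [one_mul, ContinuousMap.norm_le _ (norm_nonneg _)]
    exact fun x => p.norm_coe_le_norm _)

theorem dilation_apply (r : I) (p : C(I, 𝕜)) (x : I) : dilation 𝕜 r p x = p (r * x) := rfl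

/-- Monomials are eigenvectors of dilations. -/
theorem dilation_mem {Λ : ℕ → ℝ≥0} (r : I) {p : C(I, 𝕜)} (hp : p ∈ muntzC 𝕜 Λ) :
    dilation 𝕜 r p ∈ muntzC 𝕜 Λ := by
  have h : ∀ p ∈ muntzSpan 𝕜 Λ, dilation 𝕜 r p ∈ muntzSpan 𝕜 Λ := by
    intro p hp
    induction hp using Submodule.span_induction with
    | mem p hp =>
      obtain ⟨k, rfl⟩ := hp
      have : dilation 𝕜 r (monomial 𝕜 (Λ k)) =
          (((r : ℝ) ^ (Λ k : ℝ) : ℝ) : 𝕜) • monomial 𝕜 (Λ k) := by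
        ext x
        simp only [dilation_apply, monomial, ContinuousMap.coe_mk, ContinuousMap.smul_apply,
          smul_eq_mul, Icc.coe_mul]
        rw [Real.mul_rpow r.2.1 x.2.1, RCLike.ofReal_mul]
      simp only [this]
      exact Submodule.smul_mem _ _ (Submodule.subset_span ⟨k, rfl⟩)
    | zero => simp
    | add p q _ _ h1 h2 => rw [map_add]; exact Submodule.add_mem _ h1 h2
    | smul c p _ h => rw [map_smul]; exact Submodule.smul_mem _ _ h
  exact map_mem_closure (dilation 𝕜 r).continuous hp h

/-- Arzelà–Ascoli for the image of the unit ball, which is bounded by ‖T‖. -/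
theorem isCompactOperator_of_equicontinuous (T : X →L[𝕜] C(I, 𝕜))
    (h : Equicontinuous fun (f : Metric.closedBall (0 : X) 1) (x : I) => T f x) :
    IsCompactOperator T := by
  let Φ := ContinuousMap.linearIsometryBoundedOfCompact I 𝕜 𝕜
  set A : Set (BoundedContinuousFunction I 𝕜) := (fun f => Φ (T f)) '' Metric.closedBall (0 : X) 1
  have hA : IsCompact (closure A) := by
    refine BoundedContinuousFunction.arzela_ascoli (Metric.closedBall (0 : 𝕜) ‖T‖)
      (isCompact_closedBall _ _) A ?_ ?_
    · rintro _ x ⟨f, hf, rfl⟩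
      have hf' : ‖f‖ ≤ 1 := mem_closedBall_zero_iff.1 hf
      rw [mem_closedBall_zero_iff]
      calc ‖T f x‖ ≤ ‖T f‖ := (T f).norm_coe_le_norm x
        _ ≤ ‖T‖ * ‖f‖ := T.le_opNorm f
        _ ≤ ‖T‖ := mul_le_of_le_one_right (norm_nonneg T) hf'
    · intro x U hU
      filter_upwards [h x U hU] with y hy
      rintro ⟨_, f, hf, rfl⟩
      exact hy ⟨f, hf⟩
  rw [isCompactOperator_iff_exists_mem_nhds_image_subset_compact]
  refine ⟨Metric.closedBall 0 1, Metric.closedBall_mem_nhds _ one_pos, Φ.symm '' closure A,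
    hA.image Φ.symm.continuous, ?_⟩
  rintro _ ⟨f, hf, rfl⟩
  exact ⟨Φ (T f), subset_closure ⟨f, hf, rfl⟩, Φ.symm_apply_apply _⟩

/-- An operator into `C([0,1])` which maps the unit ball to a family that is equicontinuous away
from `1`, and differs little near `1` from an operator `F` of Volterra type. -/
structure IsVolterraLike (T F : X →L[𝕜] C(I, 𝕜)) (K : ℝ) : Prop where
  equicontinuousAt : ∀ x : I, x < 1 →
    EquicontinuousAt (fun (f : Metric.closedBall (0 : X) 1) (x : I) => T f x) x
  norm_sub_add_le : ∀ f, ∀ r x : I, r ≤ x → ‖F f x - F f r‖ + ‖F f 1 - F f x‖ ≤ ‖f‖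
  norm_sub_le_mul : ∀ f, ∀ x : I, ‖T f x - F f x‖ ≤ K * (1 - x) * ‖f‖

/-- Equicontinuity is uniform on the compact interval [0, s]. -/
theorem IsVolterraLike.exists_norm_sub_le {T F : X →L[𝕜] C(I, 𝕜)} {K : ℝ}
    (h : IsVolterraLike T F K) {s : I} (hs : s < 1) {ε : ℝ} (hε : 0 < ε) :
    ∃ η : ℝ, 0 < η ∧ ∀ x y : I, x ≤ s → y ≤ s → |(x : ℝ) - y| < η → ∀ f : X, ‖f‖ ≤ 1 →
      ‖T f x - T f y‖ < ε := by
  have : CompactSpace (Iic s) := isCompact_iff_compactSpace.1 isClosed_Iic.isCompact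
  have heq : Equicontinuous fun (f : Metric.closedBall (0 : X) 1) (x : Iic s) => T f x := by
    intro x U hU
    have := h.equicontinuousAt x (lt_of_le_of_lt x.2 hs) U hU
    exact continuous_subtype_val.continuousAt.eventually this
  have := CompactSpace.uniformEquicontinuous_of_equicontinuous heq
  obtain ⟨η, hη, hη'⟩ := Metric.uniformEquicontinuous_iff.1 this ε hε
  refine ⟨η, hη, fun x y hx hy hxy f hf => ?_⟩
  rw [← dist_eq_norm]
  exact hη' ⟨x, hx⟩ ⟨y, hy⟩ hxy ⟨f, mem_closedBall_zero_iff.2 hf⟩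

/-- A compact approximation of `T`. -/
def compactApprox (T : X →L[𝕜] C(I, 𝕜)) (e : C(I, 𝕜)) (r : I) : X →L[𝕜] C(I, 𝕜) :=
  dilation 𝕜 r ∘L T + (2⁻¹ : 𝕜) •
    ((ContinuousMap.evalCLM 𝕜 (1 : I) - ContinuousMap.evalCLM 𝕜 r) ∘L T).smulRight e

theorem compactApprox_apply (T : X →L[𝕜] C(I, 𝕜)) (e : C(I, 𝕜)) (r : I) (f : X) (x : I) :
    compactApprox T e r f x = T f (r * x) + 2⁻¹ * ((T f 1 - T f r) * e x) := rfl

theorem compactApprox_mem {T : X →L[𝕜] C(I, 𝕜)} {e : C(I, 𝕜)} {r : I} {Y : Submodule 𝕜 C(I, 𝕜)}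
    (hT : ∀ f, dilation 𝕜 r (T f) ∈ Y) (he : e ∈ Y) (f : X) : compactApprox T e r f ∈ Y :=
  Y.add_mem (hT f) (Y.smul_mem _ (Y.smul_mem _ he))

theorem IsVolterraLike.isCompactOperator_compactApprox {T F : X →L[𝕜] C(I, 𝕜)} {K : ℝ}
    (h : IsVolterraLike T F K) (e : C(I, 𝕜)) {r : I} (hr : r < 1) :
    IsCompactOperator (compactApprox T e r) := by
  have h1 : IsCompactOperator (dilation 𝕜 r ∘L T) := by
    refine isCompactOperator_of_equicontinuous _ fun x U hU => ?_
    have hlt : r * x < 1 := lt_of_le_of_lt unitInterval.mul_le_left hr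
    have hc : ContinuousAt (fun x : I => r * x) x := by fun_prop
    exact hc.eventually (h.equicontinuousAt (r * x) hlt U hU)
  have h2 : IsCompactOperator
      (((ContinuousMap.evalCLM 𝕜 (1 : I) - ContinuousMap.evalCLM 𝕜 r) ∘L T).smulRight e) := by
    have h3 : IsCompactOperator
        ((ContinuousMap.evalCLM 𝕜 (1 : I) - ContinuousMap.evalCLM 𝕜 r) ∘L T) :=
      isCompactOperator_of_locallyCompactSpace_dom _
    exact h3.clm_comp ((ContinuousLinearMap.id 𝕜 𝕜).smulRight e)
  exact h1.add (h2.smul _)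

/-- For x ≤ 1 − δ the dilation barely moves x, and half the jump remains. For x close to 1, r x is
close to r, e x is close to 1 and T is close to F, so half the difference of two increments of F
remains. Between these zones nothing is claimed. -/
theorem IsVolterraLike.exists_compactApprox {T F : X →L[𝕜] C(I, 𝕜)} {K : ℝ}
    (h : IsVolterraLike T F K) (hK : 0 ≤ K) {e : C(I, 𝕜)} (he1 : e 1 = 1) (he : ∀ x, ‖e x‖ ≤ 1)
    {ε δ : ℝ} (hε : 0 < ε) (hδ : 0 < δ) :
    ∃ r : I, r < 1 ∧ ∃ δ' : ℝ, 0 < δ' ∧ ∀ f : X, ‖f‖ ≤ 1 → ∀ x : I,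
      (x : ℝ) ≤ 1 - δ ∨ 1 - δ' ≤ (x : ℝ) → ‖T f x - compactApprox T e r f x‖ ≤ 1 / 2 + ε := by

  obtain ⟨s, hs, hsδ⟩ : ∃ s : I, s < 1 ∧ ∀ x : I, (x : ℝ) ≤ 1 - δ → x ≤ s := by
    refine ⟨⟨1 - min δ 1, by have := min_le_right δ 1; linarith,
      by have := lt_min hδ one_pos; linarith⟩, ?_, fun x hx => ?_⟩
    · change (1 - min δ 1 : ℝ) < 1
      have := lt_min hδ one_pos
      linarith
    · change (x : ℝ) ≤ 1 - min δ 1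
      have := min_le_left δ 1
      linarith
  obtain ⟨η, hη, hη'⟩ := h.exists_norm_sub_le hs (half_pos hε)
  -- Here 1 − r = t: t < η controls the dilation on [0, s], K t ≤ ε/4 controls T − F on [r, 1], and
  -- t ≤ 1/2 keeps r in the interval.
  set t := min (η / 2) (min (ε / (4 * (K + 1))) (1 / 2)) with htdef
  have ht0 : 0 < t := by positivity
  have ht1 : t ≤ η / 2 := min_le_left _ _
  have ht2 : t ≤ ε / (4 * (K + 1)) := (min_le_right _ _).trans (min_le_left _ _)
  have ht3 : t ≤ 1 / 2 := (min_le_right _ _).trans (min_le_right _ _)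
  have hKt : K * t ≤ ε / 4 := by
    rw [le_div_iff₀ (by positivity)] at ht2
    nlinarith
  set r : I := ⟨1 - t, by linarith, by linarith⟩ with hrdef
  have hrv : (r : ℝ) = 1 - t := rfl
  have hr : r < 1 := by
    change (r : ℝ) < 1
    linarith
  -- This modulus, and therefore δ', can only be chosen after r.
  obtain ⟨η₂, hη₂, hη₂'⟩ := h.exists_norm_sub_le hr (by positivity : 0 < ε / 4)
  have hecont : ∀ᶠ x in nhds (1 : I), (1 + K) * ‖1 - e x‖ / 2 < ε / 4 := by
    have : ContinuousAt (fun x : I => (1 + K) * ‖1 - e x‖ / 2) 1 := by fun_prop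
    refine this.eventually_lt_const ?_
    simp [he1, hε]
  obtain ⟨η₃, hη₃, hη₃'⟩ := Metric.eventually_nhds_iff.1 hecont
  refine ⟨r, hr, min t (min (η₂ / 2) (η₃ / 2)), by positivity, fun f hf x hx => ?_⟩
  have hF1 : ‖T f 1 - F f 1‖ = 0 := by
    have := h.norm_sub_le_mul f 1
    rw [Icc.coe_one, sub_self, mul_zero, zero_mul] at this
    exact le_antisymm this (norm_nonneg _)
  have hTF : ∀ y : I, r ≤ y → ‖T f y - F f y‖ ≤ ε / 4 := by
    intro y hy
    have hy' : (1 : ℝ) - y ≤ t := by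
      have : (r : ℝ) ≤ y := hy
      linarith
    have hy0 : 0 ≤ (1 : ℝ) - y := by linarith [y.2.2]
    calc _ ≤ K * (1 - y) * ‖f‖ := h.norm_sub_le_mul f y
      _ ≤ K * t * 1 := by gcongr
      _ ≤ ε / 4 := by linarith
  have hJ : ‖T f 1 - T f r‖ ≤ 1 + ε / 4 := by
    have h1 := h.norm_sub_add_le f r 1 unitInterval.le_one'
    rw [sub_self, norm_zero, add_zero] at h1
    calc ‖T f 1 - T f r‖ = ‖(T f 1 - F f 1) + (F f 1 - F f r) - (T f r - F f r)‖ := by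
          congr 1; ring
      _ ≤ ‖T f 1 - F f 1‖ + ‖F f 1 - F f r‖ + ‖T f r - F f r‖ :=
          (norm_sub_le _ _).trans (add_le_add_left (norm_add_le _ _) _)
      _ ≤ 0 + 1 + ε / 4 := add_le_add (add_le_add hF1.le (h1.trans hf)) (hTF r le_rfl)
      _ = _ := by ring
  have hJK : ‖T f 1 - T f r‖ ≤ 1 + K := by
    have h1 := h.norm_sub_add_le f r 1 unitInterval.le_one'
    rw [sub_self, norm_zero, add_zero] at h1
    have h2 := h.norm_sub_le_mul f r
    have h3 : K * (1 - r) * ‖f‖ ≤ K := by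
      have : (1 : ℝ) - r ≤ 1 := by linarith [r.2.1]
      have h0 : 0 ≤ (1 : ℝ) - r := by linarith [r.2.2]
      calc K * (1 - r) * ‖f‖ ≤ K * 1 * 1 := by gcongr
        _ = K := by ring
    calc ‖T f 1 - T f r‖ = ‖(T f 1 - F f 1) + (F f 1 - F f r) - (T f r - F f r)‖ := by
          congr 1; ring
      _ ≤ ‖T f 1 - F f 1‖ + ‖F f 1 - F f r‖ + ‖T f r - F f r‖ :=
          (norm_sub_le _ _).trans (add_le_add_left (norm_add_le _ _) _)
      _ ≤ 0 + 1 + K := add_le_add (add_le_add hF1.le (h1.trans hf)) (h2.trans h3)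
      _ = _ := by ring
  have hhalf : ‖(2⁻¹ : 𝕜)‖ = 1 / 2 := by simp
  have hrx : ((r * x : I) : ℝ) = (1 - t) * x := rfl
  rw [compactApprox_apply]
  rcases hx with hx | hx
  · have hxs := hsδ x hx
    have h1 : ‖T f x - T f (r * x)‖ < ε / 2 := by
      refine hη' x (r * x) hxs (unitInterval.mul_le_right.trans hxs) ?_ f hf
      rw [hrx, show (x : ℝ) - (1 - t) * x = t * x by ring, abs_of_nonneg (mul_nonneg ht0.le x.2.1)]
      have := x.2.2
      nlinarith
    calc ‖T f x - (T f (r * x) + 2⁻¹ * ((T f 1 - T f r) * e x))‖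
        = ‖(T f x - T f (r * x)) - 2⁻¹ * ((T f 1 - T f r) * e x)‖ := by congr 1; ring
      _ ≤ ‖T f x - T f (r * x)‖ + ‖2⁻¹ * ((T f 1 - T f r) * e x)‖ := norm_sub_le _ _
      _ ≤ ε / 2 + 1 / 2 * ((1 + ε / 4) * 1) := by
          rw [norm_mul, norm_mul, hhalf]
          have := he x
          gcongr
      _ ≤ _ := by linarith
  · have hx1 : (1 : ℝ) - x ≤ t := by
      have := min_le_left t (min (η₂ / 2) (η₃ / 2))
      linarith
    have hx2 : (1 : ℝ) - x < η₂ := by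
      have := (min_le_right t (min (η₂ / 2) (η₃ / 2))).trans (min_le_left _ _)
      linarith
    have hx3 : (1 : ℝ) - x < η₃ := by
      have := (min_le_right t (min (η₂ / 2) (η₃ / 2))).trans (min_le_right _ _)
      linarith
    have hrx' : r ≤ x := by
      change (r : ℝ) ≤ x
      linarith
    have h1 : ‖T f r - T f (r * x)‖ < ε / 4 := by
      refine hη₂' r (r * x) le_rfl unitInterval.mul_le_left ?_ f hf
      rw [hrx, hrv, show (1 - t) - (1 - t) * (x : ℝ) = (1 - t) * (1 - x) by ring,
        abs_of_nonneg (mul_nonneg (by linarith) (by linarith [x.2.2]))]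
      have := x.2.2
      nlinarith
    have h2 : ‖2⁻¹ * ((T f 1 - T f r) * (1 - e x))‖ ≤ ε / 4 := by
      have h3 := hη₃' (y := x) (by
        change |(x : ℝ) - 1| < η₃
        rw [abs_sub_comm, abs_of_nonneg (by linarith [x.2.2])]
        exact hx3)
      rw [norm_mul, norm_mul, hhalf]
      calc 1 / 2 * (‖T f 1 - T f r‖ * ‖1 - e x‖) ≤ 1 / 2 * ((1 + K) * ‖1 - e x‖) := by gcongr
        _ ≤ ε / 4 := by linarith
    have h3 : ‖2⁻¹ * ((F f x - F f r) - (F f 1 - F f x))‖ ≤ 1 / 2 := by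
      rw [norm_mul, hhalf]
      have := (norm_sub_le (F f x - F f r) (F f 1 - F f x)).trans
        ((h.norm_sub_add_le f r x hrx').trans hf)
      linarith
    have h4 := hTF x hrx'
    have h5 : ‖2⁻¹ * (T f r - F f r)‖ ≤ ε / 8 := by
      rw [norm_mul, hhalf]
      have := hTF r le_rfl
      linarith
    have h6 : ‖2⁻¹ * (T f 1 - F f 1)‖ = 0 := by rw [norm_mul, hF1, mul_zero]
    have e2 : (2 : 𝕜) ≠ 0 := two_ne_zero
    calc ‖T f x - (T f (r * x) + 2⁻¹ * ((T f 1 - T f r) * e x))‖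
        = ‖2⁻¹ * ((F f x - F f r) - (F f 1 - F f x)) + (T f x - F f x) - 2⁻¹ * (T f r - F f r)
            - 2⁻¹ * (T f 1 - F f 1) + (T f r - T f (r * x)) +
            2⁻¹ * ((T f 1 - T f r) * (1 - e x))‖ := by
          congr 1
          field_simp
          ring
      _ ≤ ‖2⁻¹ * ((F f x - F f r) - (F f 1 - F f x))‖ + ‖T f x - F f x‖ + ‖2⁻¹ * (T f r - F f r)‖
            + ‖2⁻¹ * (T f 1 - F f 1)‖ + ‖T f r - T f (r * x)‖ +
            ‖2⁻¹ * ((T f 1 - T f r) * (1 - e x))‖ := by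
          refine (norm_add_le _ _).trans (add_le_add_left ?_ _)
          refine (norm_add_le _ _).trans (add_le_add_left ?_ _)
          refine (norm_sub_le _ _).trans (add_le_add_left ?_ _)
          refine (norm_sub_le _ _).trans (add_le_add_left ?_ _)
          exact norm_add_le _ _
      _ ≤ 1 / 2 + ε := by linarith

theorem norm_sub_compactApprox_le (T : X →L[𝕜] C(I, 𝕜)) {e : C(I, 𝕜)} (he : ∀ x, ‖e x‖ ≤ 1)
    (r : I) {f : X} (hf : ‖f‖ ≤ 1) (x : I) : ‖T f x - compactApprox T e r f x‖ ≤ 3 * ‖T‖ := by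
  have h : ∀ y, ‖T f y‖ ≤ ‖T‖ := fun y =>
    ((T f).norm_coe_le_norm y).trans ((T.le_opNorm f).trans
      (mul_le_of_le_one_right (norm_nonneg T) hf))
  have hhalf : ‖(2⁻¹ : 𝕜)‖ = 1 / 2 := by simp
  rw [compactApprox_apply]
  calc _ ≤ ‖T f x‖ + (‖T f (r * x)‖ + ‖2⁻¹ * ((T f 1 - T f r) * e x)‖) :=
        (norm_sub_le _ _).trans (add_le_add_right (norm_add_le _ _) _)
    _ ≤ ‖T‖ + (‖T‖ + 1 / 2 * ((‖T‖ + ‖T‖) * 1)) := by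
        rw [norm_mul, norm_mul, hhalf]
        have := he x
        have := (norm_sub_le (T f 1) (T f r)).trans (add_le_add (h 1) (h r))
        gcongr
        · exact h x
        · exact h _
    _ = _ := by ring

/-- A gliding hump: each new approximant is chosen good on [0, 1 − δ], where δ is such that all
earlier ones are good beyond 1 − δ. At any x at most one term is bad, so 3‖T‖ is paid once, whatever
N is. -/
theorem IsVolterraLike.exists_sum_compactApprox {T F : X →L[𝕜] C(I, 𝕜)} {K : ℝ}
    (h : IsVolterraLike T F K) (hK : 0 ≤ K) {e : C(I, 𝕜)} (he1 : e 1 = 1) (he : ∀ x, ‖e x‖ ≤ 1)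
    {Y : Submodule 𝕜 C(I, 𝕜)} (hY : ∀ r f, dilation 𝕜 r (T f) ∈ Y) (heY : e ∈ Y)
    {ε : ℝ} (hε : 0 < ε) (N : ℕ) :
    ∃ S : X →L[𝕜] C(I, 𝕜), IsCompactOperator S ∧ (∀ f, S f ∈ Y) ∧ ∃ δ : ℝ, 0 < δ ∧
      ∀ f : X, ‖f‖ ≤ 1 → ∀ x : I, ‖N * T f x - S f x‖ ≤ N * (1 / 2 + ε) + 3 * ‖T‖ ∧
        (1 - δ ≤ (x : ℝ) → ‖N * T f x - S f x‖ ≤ N * (1 / 2 + ε)) := by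
  induction N with
  | zero =>
    refine ⟨0, isCompactOperator_zero, fun f => Y.zero_mem, 1, one_pos, fun f _ x => ?_⟩
    simp [norm_nonneg T]
  | succ N ih =>
    obtain ⟨S, hS, hSY, δ, hδ, hSδ⟩ := ih
    obtain ⟨r, hr, δ', hδ', hr'⟩ := h.exists_compactApprox hK he1 he hε hδ
    refine ⟨S + compactApprox T e r, hS.add (h.isCompactOperator_compactApprox e hr),
      fun f => Y.add_mem (hSY f) (compactApprox_mem (hY r) heY f), min δ δ', lt_min hδ hδ',
      fun f hf x => ?_⟩
    obtain ⟨h1, h2⟩ := hSδ f hf x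
    have h3 := norm_sub_compactApprox_le T he r hf x
    have key : ‖((N + 1 : ℕ) : 𝕜) * T f x - (S + compactApprox T e r) f x‖ ≤
        ‖N * T f x - S f x‖ + ‖T f x - compactApprox T e r f x‖ := by
      refine le_trans (le_of_eq ?_) (norm_add_le _ _)
      rw [add_apply, ContinuousMap.add_apply]
      congr 1
      push_cast
      ring
    have h4 := norm_nonneg T
    push_cast at key ⊢
    constructor
    · refine key.trans ?_
      -- Up to 1 − δ the new term is good and the induction hypothesis already contains the 3‖T‖;
      -- beyond, the old sum is good and the new term may cost 3‖T‖.
      rcases le_or_gt (x : ℝ) (1 - δ) with hx | hx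
      · have := hr' f hf x (Or.inl hx)
        linarith
      · have := h2 hx.le
        linarith
    · intro hx
      have h5 := h2 (by have := min_le_left δ δ'; linarith)
      have h6 := hr' f hf x (Or.inr (by have := min_le_right δ δ'; linarith))
      linarith

theorem IsVolterraLike.exists_isCompactOperator {T F : X →L[𝕜] C(I, 𝕜)} {K : ℝ}
    (h : IsVolterraLike T F K) (hK : 0 ≤ K) {e : C(I, 𝕜)} (he1 : e 1 = 1) (he : ∀ x, ‖e x‖ ≤ 1)
    {Y : Submodule 𝕜 C(I, 𝕜)} (hY : ∀ r f, dilation 𝕜 r (T f) ∈ Y) (heY : e ∈ Y)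
    {ε : ℝ} (hε : 0 < ε) :
    ∃ S : X →L[𝕜] C(I, 𝕜), IsCompactOperator S ∧ (∀ f, S f ∈ Y) ∧ ‖T - S‖ ≤ 1 / 2 + ε := by
  obtain ⟨N, hN⟩ := exists_nat_gt (3 * ‖T‖ / (ε / 2))
  have hN0 : (0 : ℝ) < N := lt_of_le_of_lt (by positivity) hN
  obtain ⟨S, hS, hSY, _, _, hST⟩ := h.exists_sum_compactApprox hK he1 he hY heY (half_pos hε) N
  refine ⟨(N : 𝕜)⁻¹ • S, hS.smul ((N : 𝕜)⁻¹), fun f => Y.smul_mem _ (hSY f),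
    ContinuousLinearMap.opNorm_le_of_unit_norm (by positivity) fun f hf => ?_⟩
  rw [ContinuousMap.norm_le _ (by positivity)]
  intro x
  have h1 := (hST f hf.le x).1
  have hN' : (N : 𝕜) ≠ 0 := by
    have : N ≠ 0 := by rintro rfl; simp at hN0
    exact_mod_cast this
  have e1 : (T - (N : 𝕜)⁻¹ • S) f x = (N : 𝕜)⁻¹ * (N * T f x - S f x) := by
    rw [sub_apply, ContinuousMap.sub_apply, smul_apply,
      ContinuousMap.smul_apply, smul_eq_mul, mul_sub, inv_mul_cancel_left₀ hN']
  rw [e1, norm_mul, norm_inv, RCLike.norm_natCast, inv_mul_le_iff₀ hN0]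
  rw [div_lt_iff₀ (by positivity)] at hN
  linarith

end

section

variable {𝕜 : Type*} [RCLike 𝕜] {X : Type*} [NormedAddCommGroup X] [NormedSpace 𝕜 X]
  {Z : Type*} [NormedAddCommGroup Z] [NormedSpace 𝕜 Z]

/-! ### Essential norms -/

theorem isWeaklyCompactOperator_of_isCompactOperator {S : X →L[𝕜] Z} (hS : IsCompactOperator S) :
    IsWeaklyCompactOperator 𝕜 X Z S := by
  have h := hS.isCompact_closure_image_closedBall 1
  refine (h.image (toWeakSpaceCLM 𝕜 Z).continuous).closure_of_subset ?_
  exact image_mono subset_closure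

theorem IsWeaklyCompactOperator.subtypeL_comp {Y : Submodule 𝕜 Z} {S : X →L[𝕜] Y}
    (hS : IsWeaklyCompactOperator 𝕜 X Y S) :
    IsWeaklyCompactOperator 𝕜 X Z (Y.subtypeL ∘L S) := by
  refine (hS.image (WeakSpace.map Y.subtypeL).continuous).closure_of_subset ?_
  rintro _ ⟨_, ⟨f, hf, rfl⟩, rfl⟩
  exact ⟨_, subset_closure ⟨S f, ⟨f, hf, rfl⟩, rfl⟩, rfl⟩

/-- Weak cluster points in C([0,1]) are continuous, whereas the pointwise limit of T (f n) jumps by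
1 at the endpoint; approximating it within c on both sides of the jump forces 2c ≥ 1. -/
theorem half_le_norm_sub {T S : X →L[𝕜] C(I, 𝕜)} (hS : IsWeaklyCompactOperator 𝕜 X C(I, 𝕜) S)
    {f : ℕ → X} (hf : ∀ n, ‖f n‖ ≤ 1) (h1 : ∀ n, T (f n) 1 = 1)
    (h0 : ∀ x : I, x < 1 → Filter.Tendsto (fun n => T (f n) x) Filter.atTop (nhds 0)) :
    1 / 2 ≤ ‖T - S‖ := by
  set c := ‖T - S‖
  obtain ⟨g, -, hg⟩ := IsCompact.exists_mapClusterPt hS (f := Filter.atTop)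
    (u := fun n => toWeakSpace 𝕜 C(I, 𝕜) (S (f n)))
    (Filter.tendsto_principal.2 <| Filter.Eventually.of_forall fun n => subset_closure
      ⟨S (f n), ⟨f n, mem_closedBall_zero_iff.2 (hf n), rfl⟩, rfl⟩)
  set g₀ : C(I, 𝕜) := (toWeakSpace 𝕜 C(I, 𝕜)).symm g
  -- Evaluations are weakly continuous, so the weak cluster point is a pointwise cluster point.
  have heval : ∀ x : I, MapClusterPt (g₀ x) Filter.atTop fun n => S (f n) x := by
    intro x
    have hc : Continuous fun g : WeakSpace 𝕜 C(I, 𝕜) =>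
        (toWeakSpace 𝕜 C(I, 𝕜)).symm g x :=
      WeakBilin.eval_continuous (topDualPairing 𝕜 C(I, 𝕜)).flip (ContinuousMap.evalCLM 𝕜 x)
    exact hg.continuousAt_comp hc.continuousAt
  have hdiff : ∀ n x, ‖T (f n) x - S (f n) x‖ ≤ c := by
    intro n x
    calc _ ≤ ‖(T - S) (f n)‖ := ((T - S) (f n)).norm_coe_le_norm x
      _ ≤ c * ‖f n‖ := (T - S).le_opNorm _
      _ ≤ c := mul_le_of_le_one_right (norm_nonneg (T - S)) (hf n)
  have hlim : ∀ (x : I) (l : 𝕜), Filter.Tendsto (fun n => T (f n) x) Filter.atTop (nhds l) →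
      ‖l - g₀ x‖ ≤ c := by
    intro x l hl
    refine le_of_forall_pos_le_add fun ε hε => ?_
    have hfreq := (heval x).frequently (Metric.ball_mem_nhds (g₀ x) (half_pos hε))
    have hev := hl.eventually (Metric.ball_mem_nhds l (half_pos hε))
    obtain ⟨n, hn1, hn2⟩ := (hfreq.and_eventually hev).exists
    rw [dist_eq_norm] at hn1 hn2
    have := hdiff n x
    calc ‖l - g₀ x‖ = ‖(T (f n) x - S (f n) x) + (S (f n) x - g₀ x) - (T (f n) x - l)‖ := by
          congr 1; ring
      _ ≤ ‖T (f n) x - S (f n) x‖ + ‖S (f n) x - g₀ x‖ + ‖T (f n) x - l‖ :=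
          (norm_sub_le _ _).trans (add_le_add_left (norm_add_le _ _) _)
      _ ≤ c + ε := by linarith
  have hg1 : ‖g₀ 1‖ ≤ c := by
    have hclosed : IsClosed {x : I | ‖g₀ x‖ ≤ c} :=
      isClosed_le g₀.continuous.norm continuous_const
    have hsub : Iio (1 : I) ⊆ {x : I | ‖g₀ x‖ ≤ c} := fun x hx => by
      simpa using hlim x 0 (h0 x hx)
    have hmem : (1 : I) ∈ closure (Iio (1 : I)) := by
      rw [closure_Iio' ⟨0, zero_lt_one⟩]
      exact self_mem_Iic
    exact hclosed.closure_subset_iff.2 hsub hmem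
  have h2 := hlim 1 1 (tendsto_const_nhds.congr fun n => (h1 n).symm)
  have h3 : ‖(1 : 𝕜)‖ ≤ ‖1 - g₀ 1‖ + ‖g₀ 1‖ := by
    simpa using norm_add_le (1 - g₀ 1) (g₀ 1)
  rw [norm_one] at h3
  linarith

theorem weakEssNorm_le_essNorm (T : X →L[𝕜] Z) : weakEssNorm 𝕜 X Z T ≤ essNorm 𝕜 X Z T :=
  Metric.infDist_le_infDist_of_subset
    (fun _ hS => isWeaklyCompactOperator_of_isCompactOperator hS) ⟨0, isCompactOperator_zero⟩

theorem essNorm_le_norm_sub {T S : X →L[𝕜] Z} (hS : IsCompactOperator S) :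
    essNorm 𝕜 X Z T ≤ ‖T - S‖ :=
  (Metric.infDist_le_dist_of_mem (show S ∈ {S : X →L[𝕜] Z | IsCompactOperator S} from hS)).trans_eq
    (dist_eq_norm T S)

theorem half_le_weakEssNorm {T : X →L[𝕜] C(I, 𝕜)} {f : ℕ → X} (hf : ∀ n, ‖f n‖ ≤ 1)
    (h1 : ∀ n, T (f n) 1 = 1)
    (h0 : ∀ x : I, x < 1 → Filter.Tendsto (fun n => T (f n) x) Filter.atTop (nhds 0)) :
    1 / 2 ≤ weakEssNorm 𝕜 X C(I, 𝕜) T := by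
  refine (Metric.le_infDist ⟨0, isWeaklyCompactOperator_of_isCompactOperator
    isCompactOperator_zero⟩).2 fun S hS => ?_
  rw [dist_eq_norm]
  exact half_le_norm_sub hS hf h1 h0

/-- The larger target admits more approximants, and the inclusion is isometric. -/
theorem weakEssNorm_subtypeL_le {Y : Submodule 𝕜 Z} (T : X →L[𝕜] Y) :
    weakEssNorm 𝕜 X Z (Y.subtypeL ∘L T) ≤ weakEssNorm 𝕜 X Y T := by
  refine (Metric.le_infDist ⟨0, isWeaklyCompactOperator_of_isCompactOperator
    isCompactOperator_zero⟩).2 fun S hS => ?_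
  have hmem : Y.subtypeL ∘L S ∈ {S : X →L[𝕜] Z | IsWeaklyCompactOperator 𝕜 X Z S} :=
    IsWeaklyCompactOperator.subtypeL_comp hS
  refine (Metric.infDist_le_dist_of_mem hmem).trans ?_
  rw [dist_eq_norm, dist_eq_norm, ← ContinuousLinearMap.comp_sub]
  refine ContinuousLinearMap.opNorm_le_bound _ (norm_nonneg (T - S)) fun f => ?_
  exact (T - S).le_opNorm f

theorem essNorm_subtypeL_le {Y : Submodule 𝕜 Z} (T : X →L[𝕜] Y) :
    essNorm 𝕜 X Z (Y.subtypeL ∘L T) ≤ essNorm 𝕜 X Y T := by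
  refine (Metric.le_infDist ⟨0, isCompactOperator_zero⟩).2 fun S hS => ?_
  have hmem : IsCompactOperator (Y.subtypeL ∘L S) := IsCompactOperator.clm_comp hS Y.subtypeL
  refine (essNorm_le_norm_sub hmem).trans ?_
  rw [dist_eq_norm, ← ContinuousLinearMap.comp_sub]
  refine ContinuousLinearMap.opNorm_le_bound _ (norm_nonneg (T - S)) fun f => ?_
  exact (T - S).le_opNorm f

/-- All four numbers lie between the weak essential norm into C([0,1]), at least 1/2, and the
essential norm into Y, at most 1/2. -/
theorem IsVolterraLike.essNorm_eq {T F : X →L[𝕜] C(I, 𝕜)} {K : ℝ}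
    (h : IsVolterraLike T F K) (hK : 0 ≤ K) {e : C(I, 𝕜)} (he1 : e 1 = 1) (he : ∀ x, ‖e x‖ ≤ 1)
    {Y : Submodule 𝕜 C(I, 𝕜)} (hYc : IsClosed (Y : Set C(I, 𝕜)))
    (hY : ∀ r f, dilation 𝕜 r (T f) ∈ Y) (heY : e ∈ Y) (hTY : ∀ f, T f ∈ Y)
    {f : ℕ → X} (hf : ∀ n, ‖f n‖ ≤ 1) (h1 : ∀ n, T (f n) 1 = 1)
    (h0 : ∀ x : I, x < 1 → Filter.Tendsto (fun n => T (f n) x) Filter.atTop (nhds 0)) :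
    essNorm 𝕜 X Y (T.codRestrict Y hTY) = 1 / 2 ∧ weakEssNorm 𝕜 X Y (T.codRestrict Y hTY) = 1 / 2 ∧
      essNorm 𝕜 X C(I, 𝕜) (Y.subtypeL ∘L T.codRestrict Y hTY) = 1 / 2 ∧
      weakEssNorm 𝕜 X C(I, 𝕜) (Y.subtypeL ∘L T.codRestrict Y hTY) = 1 / 2 := by
  have hlow : 1 / 2 ≤ weakEssNorm 𝕜 X C(I, 𝕜) (Y.subtypeL ∘L T.codRestrict Y hTY) :=
    half_le_weakEssNorm hf h1 h0
  have hup : essNorm 𝕜 X Y (T.codRestrict Y hTY) ≤ 1 / 2 := by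
    refine le_of_forall_pos_le_add fun ε hε => ?_
    obtain ⟨S, hS, hSY, hST⟩ := h.exists_isCompactOperator hK he1 he hY heY hε
    refine (essNorm_le_norm_sub (𝕜 := 𝕜) (X := X) (Z := Y)
      (S := S.codRestrict Y hSY) (hS.codRestrict hSY hYc)).trans (le_trans ?_ hST)
    refine ContinuousLinearMap.opNorm_le_bound _ (norm_nonneg (T - S)) fun f => ?_
    exact (T - S).le_opNorm f
  have a1 := weakEssNorm_le_essNorm (𝕜 := 𝕜) (X := X) (Z := Y) (T.codRestrict Y hTY)
  have a2 := weakEssNorm_le_essNorm (𝕜 := 𝕜) (X := X) (Z := C(I, 𝕜)) (Y.subtypeL ∘L T.codRestrict Y hTY)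
  have a3 := weakEssNorm_subtypeL_le (𝕜 := 𝕜) (X := X) (Y := Y) (T.codRestrict Y hTY)
  have a4 := essNorm_subtypeL_le (𝕜 := 𝕜) (X := X) (Y := Y) (T.codRestrict Y hTY)
  refine ⟨?_, ?_, ?_, ?_⟩ <;> apply le_antisymm <;> linarith

/-! ### The normalized monomials -/

variable {Λ : ℕ → ℝ≥0}

theorem tendsto_atTop_of_muntzCondition (hΛ : StrictMono Λ) (hM : MuntzCondition Λ) :
    Filter.Tendsto (fun n => (Λ n : ℝ)) Filter.atTop Filter.atTop := by
  have h1 : Filter.Tendsto (fun n => (1 / (Λ n : ℝ))) Filter.atTop (nhdsWithin 0 (Ioi 0)) := by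
    refine tendsto_nhdsWithin_iff.2 ⟨hM.tendsto_atTop_zero, ?_⟩
    filter_upwards [Filter.eventually_ge_atTop 1] with n hn
    have : (0 : ℝ≥0) < Λ n := lt_of_le_of_lt (zero_le (a := Λ 0)) (hΛ (by omega))
    have : (0 : ℝ) < Λ n := this
    simpa using this
  refine h1.inv_tendsto_nhdsGT_zero.congr fun n => ?_
  simp

theorem tendsto_monomial (hΛ : StrictMono Λ) (hM : MuntzCondition Λ) {x : I} (hx : x < 1) :
    Filter.Tendsto (fun n => monomial 𝕜 (Λ n) x) Filter.atTop (nhds 0) := by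
  have hx0 := x.2.1
  have h := (tendsto_rpow_atTop_of_base_lt_one (x : ℝ) (by linarith) hx).comp
    (tendsto_atTop_of_muntzCondition hΛ hM)
  have := (RCLike.continuous_ofReal (K := 𝕜)).tendsto 0 |>.comp h
  simpa [monomial, Function.comp_def] using this

/-- The monomial `(λ n + 1) * x ^ λ n`, as an element of the unit sphere of `M_Λ^1`. -/
def normalizedMonomial (𝕜 : Type*) [RCLike 𝕜] (Λ : ℕ → ℝ≥0) (n : ℕ) : muntzSpan 𝕜 Λ :=
  ⟨(((Λ n : ℝ) + 1 : ℝ) : 𝕜) • monomial 𝕜 (Λ n),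
    Submodule.smul_mem _ _ (Submodule.subset_span ⟨n, rfl⟩)⟩

theorem norm_normalizedMonomial (n : ℕ) : ‖spanToL1 𝕜 Λ (normalizedMonomial 𝕜 Λ n)‖ ≤ 1 := by
  have h0 : (0 : ℝ) ≤ Λ n := (Λ n).2
  rw [norm_spanToL1, norm_toLp_eq]
  have e : ∀ t : I, ‖(normalizedMonomial 𝕜 Λ n : C(I, 𝕜)) t‖ =
      ((Λ n : ℝ) + 1) * (t : ℝ) ^ (Λ n : ℝ) := by
    intro t
    simp only [normalizedMonomial, monomial, ContinuousMap.smul_apply, ContinuousMap.coe_mk,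
      norm_smul, RCLike.norm_ofReal]
    rw [abs_of_nonneg (by positivity), abs_of_nonneg (Real.rpow_nonneg t.2.1 _)]
  simp_rw [e]
  rw [integral_unitInterval (fun t : ℝ => ((Λ n : ℝ) + 1) * t ^ (Λ n : ℝ)),
    intervalIntegral.integral_const_mul, integral_rpow (Or.inl (by linarith)),
    Real.zero_rpow (by positivity), Real.one_rpow, sub_zero, mul_one_div_cancel (by positivity)]

theorem cesaroC_normalizedMonomial (n : ℕ) :
    cesaroC 𝕜 (normalizedMonomial 𝕜 Λ n : C(I, 𝕜)) = monomial 𝕜 (Λ n) := by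
  have h0 : (0 : ℝ) < Λ n + 1 := by positivity
  change cesaroC 𝕜 ((((Λ n : ℝ) + 1 : ℝ) : 𝕜) • monomial 𝕜 (Λ n)) = _
  rw [map_smul, cesaroC_monomial, smul_smul, ← RCLike.ofReal_mul,
    mul_one_div_cancel h0.ne', RCLike.ofReal_one, one_smul]

theorem mul_monomial (a : ℝ≥0) (x : I) :
    ((x : ℝ) : 𝕜) * monomial 𝕜 a x = monomial 𝕜 (1 + a) x := by
  simp only [monomial, ContinuousMap.coe_mk]
  rw [← RCLike.ofReal_mul, NNReal.coe_add, NNReal.coe_one, Real.rpow_one_add' x.2.1 (by positivity)]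

theorem monomial_one_apply (a : ℝ≥0) : monomial 𝕜 a 1 = 1 := by
  simp [monomial]

theorem norm_monomial_apply_le (a : ℝ≥0) (x : I) : ‖monomial 𝕜 a x‖ ≤ 1 := by
  simp only [monomial, ContinuousMap.coe_mk, RCLike.norm_ofReal]
  rw [abs_of_nonneg (Real.rpow_nonneg x.2.1 _)]
  exact Real.rpow_le_one x.2.1 x.2.2 a.2

theorem monomial_mem_muntzC (n : ℕ) : monomial 𝕜 (Λ n) ∈ muntzC 𝕜 Λ :=
  Submodule.le_topologicalClosure _ (Submodule.subset_span ⟨n, rfl⟩)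

/-- The Volterra operator on `M_Λ^1`, with values in `C([0,1])`. -/
def volterraMuntz (𝕜 : Type*) [RCLike 𝕜] (Λ : ℕ → ℝ≥0) : muntzL1 𝕜 Λ →L[𝕜] C(I, 𝕜) :=
  volterraL 𝕜 ∘L (muntzL1 𝕜 Λ).subtypeL

theorem volterraMuntz_apply (f : muntzL1 𝕜 Λ) (x : I) :
    volterraMuntz 𝕜 Λ f x = volterra (f : Lp 𝕜 1 (volume : Measure I)) x := rfl

theorem volterraMuntz_mem (f : muntzL1 𝕜 Λ) : volterraMuntz 𝕜 Λ f ∈ muntzC 𝕜 (1 + Λ) := by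
  refine denseRange_spanToL1.induction_on
    (p := fun f => volterraMuntz 𝕜 Λ f ∈ muntzC 𝕜 (1 + Λ)) f
    (isClosed_muntzC.preimage (volterraMuntz 𝕜 Λ).continuous) fun p => ?_
  refine Submodule.le_topologicalClosure _ ?_
  change volterraL 𝕜 (ContinuousMap.toLp (E := 𝕜) 1 (volume : Measure I) 𝕜 (p : C(I, 𝕜))) ∈ _
  obtain ⟨p, hp⟩ := p
  induction hp using Submodule.span_induction with
  | mem p hp =>
    obtain ⟨k, rfl⟩ := hp
    have : volterraL 𝕜 (ContinuousMap.toLp (E := 𝕜) 1 (volume : Measure I) 𝕜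
        (monomial 𝕜 (Λ k))) = (((1 / ((Λ k : ℝ) + 1) : ℝ)) : 𝕜) • monomial 𝕜 ((1 + Λ) k) := by
      ext x
      rw [volterraL_toLp, ← mul_cesaroC (Λ := Λ) (Submodule.subset_span ⟨k, rfl⟩),
        cesaroC_monomial, ContinuousMap.smul_apply, ContinuousMap.smul_apply, Pi.add_apply,
        Pi.one_apply, ← mul_monomial, smul_eq_mul, smul_eq_mul, mul_left_comm]
    simp only [this]
    exact Submodule.smul_mem _ _ (Submodule.subset_span ⟨k, rfl⟩)
  | zero => simp
  | add p r _ _ h1 h2 => simp only [map_add] at *; exact Submodule.add_mem _ h1 h2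
  | smul c p _ h => simp only [map_smul] at *; exact Submodule.smul_mem _ _ h

theorem isVolterraLike_cesaro (hΛ : StrictMono Λ) (hM : MuntzCondition Λ)
    {Γ : muntzL1 𝕜 Λ →L[𝕜] C(I, 𝕜)}
    (hΓ : ∀ p, Γ (spanToL1 𝕜 Λ p) = cesaroC 𝕜 (p : C(I, 𝕜))) :
    IsVolterraLike Γ (volterraMuntz 𝕜 Λ) ‖Γ‖ where
  equicontinuousAt _ hx := equicontinuousAt_cesaroL hΛ hM hΓ hx
  norm_sub_add_le f _ _ h := norm_volterra_sub_add_le (f : Lp 𝕜 1 (volume : Measure I)) h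
  norm_sub_le_mul f x := by
    have h1 : ‖Γ f x‖ ≤ ‖Γ‖ * ‖f‖ := ((Γ f).norm_coe_le_norm x).trans (Γ.le_opNorm f)
    have h2 : 0 ≤ 1 - (x : ℝ) := sub_nonneg.2 x.2.2
    -- From x Γ f(x) = V f(x): the two operators differ by a factor 1 − x, negligible near 1.
    have h3 : Γ f x - volterraMuntz 𝕜 Λ f x = ((1 - (x : ℝ) : ℝ) : 𝕜) * Γ f x := by
      rw [volterraMuntz_apply, ← mul_cesaroL hΓ]
      push_cast
      ring
    rw [h3, norm_mul, RCLike.norm_ofReal, abs_of_nonneg h2]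
    calc _ ≤ (1 - (x : ℝ)) * (‖Γ‖ * ‖f‖) := by gcongr
      _ = _ := by ring

theorem isVolterraLike_volterra (hΛ : StrictMono Λ) (hM : MuntzCondition Λ) :
    IsVolterraLike (volterraMuntz 𝕜 Λ) (volterraMuntz 𝕜 Λ) 0 where
  equicontinuousAt x hx := by
    -- Since V f(x) = x Γ f(x), equicontinuity passes from the bounded family of Cesàro transforms
    -- to V.
    obtain ⟨Γ, hΓ⟩ := exists_cesaroL (𝕜 := 𝕜) hΛ hM
    have h := equicontinuousAt_cesaroL hΛ hM hΓ hx
    rw [Metric.equicontinuousAt_iff] at h ⊢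
    intro ε hε
    obtain ⟨δ, hδ, h⟩ := h (ε / 2) (half_pos hε)
    have hG := norm_nonneg Γ
    refine ⟨min δ (ε / (2 * (‖Γ‖ + 1))), by positivity, fun y hy f => ?_⟩
    have h1 := h y (hy.trans_le (min_le_left _ _)) f
    have h2 : |(y : ℝ) - x| < ε / (2 * (‖Γ‖ + 1)) := hy.trans_le (min_le_right _ _)
    have hf : ‖(f : muntzL1 𝕜 Λ)‖ ≤ 1 := mem_closedBall_zero_iff.1 f.2
    have h3 : ‖Γ f y‖ ≤ ‖Γ‖ := ((Γ f).norm_coe_le_norm y).trans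
      ((Γ.le_opNorm f).trans (mul_le_of_le_one_right hG hf))
    rw [dist_eq_norm] at h1 ⊢
    simp only [volterraMuntz_apply]
    rw [← mul_cesaroL hΓ, ← mul_cesaroL hΓ]
    rw [lt_div_iff₀ (by positivity)] at h2
    calc ‖((x : ℝ) : 𝕜) * Γ f x - ((y : ℝ) : 𝕜) * Γ f y‖
        = ‖((x : ℝ) : 𝕜) * (Γ f x - Γ f y) - (((y : ℝ) - x : ℝ) : 𝕜) * Γ f y‖ := by
          congr 1
          push_cast
          ring
      _ ≤ 1 * ‖Γ f x - Γ f y‖ + |(y : ℝ) - x| * ‖Γ‖ := by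
          refine (norm_sub_le _ _).trans ?_
          rw [norm_mul, norm_mul, RCLike.norm_ofReal, RCLike.norm_ofReal, abs_of_nonneg x.2.1]
          have := x.2.2
          gcongr
      _ < ε := by nlinarith [abs_nonneg ((y : ℝ) - x)]
  norm_sub_add_le f _ _ h := norm_volterra_sub_add_le (f : Lp 𝕜 1 (volume : Measure I)) h
  norm_sub_le_mul f x := by simp

end

end MuntzSpace

end

/-! ### The essential norms of the Cesàro and Volterra operators -/

theorem theorem4p3 {𝕜 : Type*} [RCLike 𝕜] (Λ : ℕ → ℝ≥0) (hΛ : StrictMono Λ)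
    (hM : MuntzSpace.MuntzCondition Λ) :
    (∃ Γ : MuntzSpace.muntzL1 𝕜 Λ →L[𝕜] MuntzSpace.muntzC 𝕜 Λ,
      (∀ f : MuntzSpace.muntzL1 𝕜 Λ,
        MuntzSpace.IsCesaroTransform (f : Lp 𝕜 1 (volume : Measure I)) (Γ f : C(I, 𝕜))) ∧
      MuntzSpace.essNorm 𝕜 (MuntzSpace.muntzL1 𝕜 Λ) (MuntzSpace.muntzC 𝕜 Λ) Γ = 1 / 2 ∧
      MuntzSpace.weakEssNorm 𝕜 (MuntzSpace.muntzL1 𝕜 Λ) (MuntzSpace.muntzC 𝕜 Λ) Γ = 1 / 2 ∧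
      MuntzSpace.essNorm 𝕜 (MuntzSpace.muntzL1 𝕜 Λ) C(I, 𝕜)
        ((MuntzSpace.muntzC 𝕜 Λ).subtypeL ∘L Γ) = 1 / 2 ∧
      MuntzSpace.weakEssNorm 𝕜 (MuntzSpace.muntzL1 𝕜 Λ) C(I, 𝕜)
        ((MuntzSpace.muntzC 𝕜 Λ).subtypeL ∘L Γ) = 1 / 2) ∧
    (∃ V : MuntzSpace.muntzL1 𝕜 Λ →L[𝕜] MuntzSpace.muntzC 𝕜 (1 + Λ),
      (∀ (f : MuntzSpace.muntzL1 𝕜 Λ) (x : I),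
        (V f : C(I, 𝕜)) x = MuntzSpace.volterra (f : Lp 𝕜 1 (volume : Measure I)) x) ∧
      MuntzSpace.essNorm 𝕜 (MuntzSpace.muntzL1 𝕜 Λ) (MuntzSpace.muntzC 𝕜 (1 + Λ)) V = 1 / 2 ∧
      MuntzSpace.weakEssNorm 𝕜 (MuntzSpace.muntzL1 𝕜 Λ) (MuntzSpace.muntzC 𝕜 (1 + Λ)) V = 1 / 2 ∧
      MuntzSpace.essNorm 𝕜 (MuntzSpace.muntzL1 𝕜 Λ) C(I, 𝕜)
        ((MuntzSpace.muntzC 𝕜 (1 + Λ)).subtypeL ∘L V) = 1 / 2 ∧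
      MuntzSpace.weakEssNorm 𝕜 (MuntzSpace.muntzL1 𝕜 Λ) C(I, 𝕜)
        ((MuntzSpace.muntzC 𝕜 (1 + Λ)).subtypeL ∘L V) = 1 / 2) := by
  open MuntzSpace in
  obtain ⟨Γ, hΓ⟩ := exists_cesaroL (𝕜 := 𝕜) hΛ hM
  have hΓn : ∀ n, Γ (spanToL1 𝕜 Λ (normalizedMonomial 𝕜 Λ n)) = monomial 𝕜 (Λ n) := fun n => by
    rw [hΓ, cesaroC_normalizedMonomial]
  have hVn : ∀ n x, volterraMuntz 𝕜 Λ (spanToL1 𝕜 Λ (normalizedMonomial 𝕜 Λ n)) x =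
      ((x : ℝ) : 𝕜) * monomial 𝕜 (Λ n) x := fun n x => by
    rw [volterraMuntz_apply, ← mul_cesaroL hΓ, hΓn]
  refine ⟨⟨Γ.codRestrict _ (cesaroL_mem hΓ), fun f => isCesaroTransform_cesaroL hΛ hM hΓ f, ?_⟩,
    ⟨(volterraMuntz 𝕜 Λ).codRestrict _ volterraMuntz_mem, fun f x => rfl, ?_⟩⟩
  · refine (isVolterraLike_cesaro hΛ hM hΓ).essNorm_eq (norm_nonneg Γ)
      (monomial_one_apply (Λ 0)) (norm_monomial_apply_le (Λ 0)) isClosed_muntzC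
      (fun r f => dilation_mem r (cesaroL_mem hΓ f)) (monomial_mem_muntzC 0) (cesaroL_mem hΓ)
      (f := fun n => spanToL1 𝕜 Λ (normalizedMonomial 𝕜 Λ n)) norm_normalizedMonomial
      (fun n => ?_) fun x hx => ?_
    · rw [hΓn, monomial_one_apply]
    · simp_rw [hΓn]
      exact tendsto_monomial hΛ hM hx
  · refine (isVolterraLike_volterra hΛ hM).essNorm_eq le_rfl
      (monomial_one_apply ((1 + Λ) 0)) (norm_monomial_apply_le ((1 + Λ) 0)) isClosed_muntzC
      (fun r f => dilation_mem r (volterraMuntz_mem f)) (monomial_mem_muntzC 0) volterraMuntz_mem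
      (f := fun n => spanToL1 𝕜 Λ (normalizedMonomial 𝕜 Λ n)) norm_normalizedMonomial
      (fun n => ?_) fun x hx => ?_
    · rw [hVn, monomial_one_apply]
      simp
    · simp_rw [hVn]
      simpa using (tendsto_monomial hΛ hM hx).const_mul ((x : ℝ) : 𝕜)
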